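/- Let $S$ be a non-exceptional Riemann surface (connected, with non-abelian fundamental group), and let $\pi_U : U \to S$ be an unbranched abelian Galois covering of Riemann surfaces with deck group $\widehat{\mathcal A}$ of exponent $e \in \{1,2,\dots\}\cup\{\infty\}$. Let $\widetilde\varphi : S \to T$ be a (possibly branched) Galois covering of Riemann surfaces with cyclic deck group $L=\langle\varphi\rangle\cong\mathbb Z_l$, $1\le l<\infty$. Let $k$ be $e$, or more generally a multiple of $e$, or $k=\infty$. Write $S=\mathbb H/\Gamma$ with $\Gamma$ a torsion-free Fuchsian group, let $\Gamma_k$ be the subgroup of $\Gamma$ generated by all commutators and (if $k\neq\infty$) all $k$-th powers, let $\widetilde S_k=\mathbb H/\Gamma_k$ be the $k$-homology cover of $S$, $\pi_k:\widetilde S_k\to S$ the induced covering, $M_k=\Gamma/\Gamma_k$ its deck group, and let $\widetilde L_k$ be the group of all conformal automorphisms of $\widetilde S_k$ that are lifts of elements of $L$. Then there is a holomorphic unbranched Galois covering $q:\widetilde S_k\to U$ with $\pi_U\circ q=\pi_k$. For any such $q$, let $N_1\le M_k$ be its deck group (so $U=\widetilde S_k/N_1$), let $N_2$ be the core of $N_1$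 in $\widetilde L_k$, and put $\mathcal K=M_k/N_2$. The Galois closure of $\widetilde\varphi\circ\pi_U : U\to T$ is the minimal (possibly branched) Galois covering $\widetilde\psi: Z\to T$ that factors as $\widetilde\psi=\widetilde\varphi\circ\pi_U\circ f$ with $f:Z\to U$ holomorphic; here minimal means that whenever $f=f'\circ h$ with $h:Z\to W$, $f':W\to U$ holomorphic, $W$ a Riemann surface and $\widetilde\varphi\circ\pi_U\circ f'$ a Galois covering, $h$ is biholomorphic. It exists. If either (i) $\varphi$ has a fixed point on $S$, or (ii) $e$ is finite and $l$ is relatively prime to $e$, then the deck group of the Galois closure $Z\to T$ is isomorphic to $\mathcal K\rtimes\mathbb Z_l$, where a generator of $\mathbb Z_l$ acts on $\mathcal K$ by conjugation with any lift of $\varphi$ to $\widetilde S_k$, and the isomorphism can be chosen so that the projection $\mathcal K\rtimes\mathbb Z_l\to\mathbb Z_l$ corresponds to the natural homomorphism from the deck group onto $L=\langle\varphi\rangle$ (the generator $1\in\mathbb Z_l$ corresponding to $\varphi$). -/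

import Mathlib

open scoped Manifold ContDiff

universe u

/-- A Riemann surface: a connected Hausdorff complex manifold of dimension one.
(Second countability is automatic.) -/
class RiemannSurface (X : Type*) [TopologicalSpace X] [ChartedSpace ℂ X] : Prop
    extends T2Space X, ConnectedSpace X, IsManifold 𝓘(ℂ) ω X

/-- Holomorphic maps between complex one-dimensional manifolds. -/
def Holomorphic {X Y : Type*} [TopologicalSpace X] [ChartedSpace ℂ X]
    [TopologicalSpace Y] [ChartedSpace ℂ Y] (f : X → Y) : Prop :=
  MDifferentiable 𝓘(ℂ) 𝓘(ℂ) f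

/-- A Riemann surface is non-exceptional if its fundamental group is not abelian. -/
def IsNonExceptional (X : Type*) [TopologicalSpace X] : Prop :=
  ∃ (x : X) (a b : FundamentalGroup X x), a * b ≠ b * a

/-- `Aut(X)`: the group of biholomorphic self-maps of `X`. -/
def holoAut (X : Type*) [TopologicalSpace X] [ChartedSpace ℂ X] : Subgroup (X ≃ₜ X) where
  carrier := {g | Holomorphic g ∧ Holomorphic g.symm}
  mul_mem' := fun {a b} ha hb =>
    ⟨MDifferentiable.comp (g := a) (f := b) ha.1 hb.1,
      MDifferentiable.comp (g := b.symm) (f := a.symm) hb.2 ha.2⟩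
  one_mem' := ⟨mdifferentiable_id, mdifferentiable_id⟩
  inv_mem' := fun {_} ha => ⟨ha.2, ha.1⟩

/-- The deck group of `p : X → Y`: the biholomorphic self-maps `g` of `X` with `p ∘ g = p`. -/
def deckGroup {X Y : Type*} [TopologicalSpace X] [ChartedSpace ℂ X] (p : X → Y) :
    Subgroup (X ≃ₜ X) where
  carrier := {g | g ∈ holoAut X ∧ ∀ x, p (g x) = p x}
  mul_mem' := fun {a b} ha hb =>
    ⟨mul_mem ha.1 hb.1, fun x => (ha.2 (b x)).trans (hb.2 x)⟩
  one_mem' := ⟨one_mem _, fun _ => rfl⟩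
  inv_mem' := fun {a} ha => ⟨inv_mem ha.1, fun x => by
    have h := ha.2 (a.symm x)
    rw [Homeomorph.apply_symm_apply] at h
    exact h.symm⟩

/-- For `π : X → Y` and a group `L` of self-maps of `Y`, the group of all biholomorphic self-maps
`g` of `X` that are lifts of some `t ∈ L`, that is, `π ∘ g = t ∘ π`. -/
def liftGroup {X Y : Type*} [TopologicalSpace X] [ChartedSpace ℂ X] [TopologicalSpace Y]
    (π : X → Y) (L : Subgroup (Y ≃ₜ Y)) : Subgroup (X ≃ₜ X) where
  carrier := {g | g ∈ holoAut X ∧ ∃ t ∈ L, ∀ x, π (g x) = t (π x)}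
  mul_mem' := by
    rintro a b ⟨ha, t, ht, hat⟩ ⟨hb, s, hs, hbs⟩
    refine ⟨mul_mem ha hb, t * s, mul_mem ht hs, fun x => ?_⟩
    exact (hat (b x)).trans (congrArg t (hbs x))
  one_mem' := ⟨one_mem _, 1, one_mem _, fun _ => rfl⟩
  inv_mem' := by
    rintro a ⟨ha, t, ht, hat⟩
    refine ⟨inv_mem ha, t⁻¹, inv_mem ht, fun x => ?_⟩
    have h := hat (a.symm x)
    rw [Homeomorph.apply_symm_apply] at h
    have h2 : t.symm (π x) = π (a.symm x) := by rw [h, Homeomorph.symm_apply_apply]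
    exact h2.symm

/-- A (possibly branched) Galois covering `p : X → Y` of Riemann surfaces: a surjective
holomorphic map whose fibres are the orbits of its deck group, so that `Y = X / deckGroup p`.
For Riemann surfaces this makes `p` a (possibly branched) covering: it is a local homeomorphism
away from a discrete set, and near each point it looks like `z ↦ z ^ n`. -/
structure IsGaloisCovering {X Y : Type*} [TopologicalSpace X] [ChartedSpace ℂ X]
    [TopologicalSpace Y] [ChartedSpace ℂ Y] (p : X → Y) : Prop where
  holomorphic : Holomorphic p
  surjective : Function.Surjective p
  transitive : ∀ x y : X, p x = p y → ∃ g ∈ deckGroup p, g x = y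

/-- An unbranched Galois covering: a Galois covering that is a topological covering map. -/
structure IsUnbranchedGaloisCovering {X Y : Type*} [TopologicalSpace X] [ChartedSpace ℂ X]
    [TopologicalSpace Y] [ChartedSpace ℂ Y] (p : X → Y) : Prop extends IsGaloisCovering p where
  isCoveringMap : IsCoveringMap p

/-- For a subgroup `Γ`, the subgroup `Γ_k` generated by all commutators and all `k`-th powers of
elements of `Γ`. The value `k = 0` stands for `k = ∞`: then only commutators remain. -/
def powCommutator {G : Type*} [Group G] (k : ℕ) (Γ : Subgroup G) : Subgroup G :=
  ⁅Γ, Γ⁆ ⊔ Subgroup.closure ((fun g => g ^ k) '' (Γ : Set G))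

/-- `π : X → S` is a `k`-homology cover of `S` (`k = 0` stands for `k = ∞`): there is a
holomorphic universal covering `π ∘ u : ℍ → S`, with deck group `Γ` (so `S = ℍ / Γ`), such that
`u : ℍ → X` is an unbranched Galois covering with deck group `Γ_k` (so `X = ℍ / Γ_k`). -/
def IsHomologyCover {X S : Type*} [TopologicalSpace X] [ChartedSpace ℂ X]
    [TopologicalSpace S] [ChartedSpace ℂ S] (k : ℕ) (π : X → S) : Prop :=
  ∃ u : UpperHalfPlane → X, IsUnbranchedGaloisCovering u ∧ IsUnbranchedGaloisCovering (π ∘ u) ∧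
    deckGroup u = powCommutator k (deckGroup (π ∘ u))

/-- `p ∘ f : Z → T` is a Galois closure of `p : U → T`: a Galois (possibly branched) covering that
factors through `p`, and minimal with this property, i.e. whenever `Z → W → U` is a factorization
of `f` such that `W → T` is again Galois, then `Z → W` is biholomorphic. -/
structure IsGaloisClosure {Z U T : Type u} [TopologicalSpace Z] [ChartedSpace ℂ Z]
    [TopologicalSpace U] [ChartedSpace ℂ U] [TopologicalSpace T] [ChartedSpace ℂ T]
    (p : U → T) (f : Z → U) : Prop where
  holomorphic : Holomorphic f
  galois : IsGaloisCovering (p ∘ f)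
  minimal : ∀ (W : Type u) [TopologicalSpace W] [ChartedSpace ℂ W] [RiemannSurface W]
    (f' : W → U) (h : Z → W), Holomorphic f' → IsGaloisCovering (p ∘ f') → Holomorphic h →
    f' ∘ h = f → ∃ h' : W → Z, Holomorphic h' ∧ h' ∘ h = id ∧ h ∘ h' = id

section Core

variable {X S U : Type*} [TopologicalSpace X] [ChartedSpace ℂ X] [TopologicalSpace S]

/-- `M_k`, the deck group of `π : X → S`, as a (normal) subgroup of the lift of `L` to `X`. -/
abbrev deckInLift (π : X → S) (L : Subgroup (S ≃ₜ S)) : Subgroup (liftGroup π L) :=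
  (deckGroup π).subgroupOf (liftGroup π L)

/-- `N₂`: the core, in the lift of `L` to `X`, of the deck group `N₁` of `q : X → U`. -/
abbrev coreInLift (π : X → S) (L : Subgroup (S ≃ₜ S)) (q : X → U) : Subgroup (liftGroup π L) :=
  ((deckGroup q).subgroupOf (liftGroup π L)).normalCore

/-- The quotient `K = M_k / N₂`. -/
abbrev coreQuotient (π : X → S) (L : Subgroup (S ≃ₜ S)) (q : X → U) : Type _ :=
  deckInLift π L ⧸ (coreInLift π L q).subgroupOf (deckInLift π L)

end Core

/-! Write Λ for the group of lifts of L to the homology cover X. The subgroup Γ_k is preserved by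
everything that normalises Γ, so automorphisms of S lift from S to ℍ and then descend to X, with any
admissible value at a point (`IsHomologyCover.exists_lift`). Hence Λ is transitive on the fibres of
X → T, and M_k is the kernel of Λ → L. As Γ_k contains the commutators, M_k is abelian. The map q
exists because Γ acts on U through an abelian group whose exponent divides k, so that Γ_k acts
trivially (`IsHomologyCover.exists_factor`).

The Galois closure is Z = X / N₂. As N₂ is normal in Λ, all of Λ descends to Z, which makes Z → T
Galois with deck group Λ / N₂. Two points of X have the same image in Z exactly when no q ∘ g with g
∈ Λ separates them. Let f' : W → U be such that W → T is Galois. Over an unramified point of T the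
germ of q ∘ g agrees, on the fibre product of X and W over U, with that of f' ∘ a for some deck
transformation a of W → T. By analytic continuation (`eq_along_path`) the value of q ∘ g at the end
of a lifted path depends only on the end of the path in W. So f' factors through Z
(`IsCoreQuotient.exists_map`), which gives minimality and identifies every Galois closure with Z.

It remains to split the extension of ℤ / l by K = M_k / N₂, that is, to find s ∈ Λ over φ with s ^ l
∈ N₂. If φ has a fixed point, a lift that fixes a point above it has trivial l-th power, since a
deck transformation with a fixed point is the identity. If l is prime to e, take Ψ ^ m for a lift Ψ
of φ and a multiple m of e with m ≡ 1 mod l: its l-th power is a power of an e-th power in M_k, and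
e-th powers lie in N₂. Since M_k is abelian, all lifts of φ induce the same conjugation on K. -/

open Filter Topology Set

/-! ### Local theory of holomorphic maps in charts -/

section LocalTheory

variable {X Y Z : Type*} [TopologicalSpace X] [ChartedSpace ℂ X]
  [TopologicalSpace Y] [ChartedSpace ℂ Y] [TopologicalSpace Z] [ChartedSpace ℂ Z]

/-- `f` is holomorphic in a neighbourhood of `x`. -/
def HolomorphicAt (f : X → Y) (x : X) : Prop :=
  ∀ᶠ y in 𝓝 x, MDifferentiableAt 𝓘(ℂ) 𝓘(ℂ) f y

theorem Holomorphic.holomorphicAt {f : X → Y} (hf : Holomorphic f) (x : X) :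
    HolomorphicAt f x := Eventually.of_forall fun y => hf y

theorem holomorphic_of_forall {f : X → Y} (hf : ∀ x, HolomorphicAt f x) : Holomorphic f :=
  fun x => (hf x).self_of_nhds

theorem Holomorphic.continuous {f : X → Y} (hf : Holomorphic f) : Continuous f :=
  MDifferentiable.continuous hf

theorem Holomorphic.comp {g : Y → Z} {f : X → Y} (hg : Holomorphic g) (hf : Holomorphic f) :
    Holomorphic (g ∘ f) := MDifferentiable.comp hg hf

theorem HolomorphicAt.continuousAt {f : X → Y} {x : X} (hf : HolomorphicAt f x) :
    ContinuousAt f x := hf.self_of_nhds.continuousAt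

theorem HolomorphicAt.comp {g : Y → Z} {f : X → Y} {x : X} (hg : HolomorphicAt g (f x))
    (hf : HolomorphicAt f x) : HolomorphicAt (g ∘ f) x := by
  filter_upwards [hf, hf.continuousAt.eventually hg] with y h1 h2
  exact MDifferentiableAt.comp y h2 h1

theorem HolomorphicAt.congr {f g : X → Y} {x : X} (hf : HolomorphicAt f x) (h : f =ᶠ[𝓝 x] g) :
    HolomorphicAt g x := by
  filter_upwards [hf, h.eventuallyEq_nhds] with y h1 h2
  exact h1.congr_of_eventuallyEq h2.symm

/-- Injectivity keeps the derivative from vanishing identically near a point, so its zeros are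
isolated. The inverse is differentiable off the images of these zeros and continuous there, and the
singularities are removable. There is thus no need to know that the derivative of an injective map
never vanishes. -/
theorem OpenPartialHomeomorph.holomorphicAt_symm_of_complex (e : OpenPartialHomeomorph ℂ ℂ)
    (he : DifferentiableOn ℂ e e.source) : DifferentiableOn ℂ e.symm e.target := by
  have key : ∀ z ∈ e.source, AnalyticAt ℂ e.symm (e z) := by
    intro z hz
    have ha : AnalyticAt ℂ e z := he.analyticAt (e.open_source.mem_nhds hz)
    have hpun : ∀ᶠ w in 𝓝[≠] z, deriv e w ≠ 0 := by
      refine ha.deriv.eventually_eq_zero_or_eventually_ne_zero.resolve_left fun h0 => ?_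
      obtain ⟨r, hr, hball⟩ := Metric.eventually_nhds_iff_ball.1
        (h0.and (e.open_source.mem_nhds hz))
      have hconst : ∀ w ∈ Metric.ball z r, e w = e z := by
        intro w hw
        refine (Metric.isOpen_ball.is_const_of_deriv_eq_zero
          (convex_ball z r).isPreconnected ?_ ?_ hw (Metric.mem_ball_self hr))
        · exact he.mono fun w hw => (hball w hw).2
        · exact fun w hw => (hball w hw).1
      -- A second point of the ball on which `e` would be constant, against injectivity.
      have hw : z + (r / 2 : ℝ) ∈ Metric.ball z r := by
        simp [abs_of_pos hr, hr]
      have := e.injOn (hball _ hw).2 hz (hconst _ hw)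
      simp [hr.ne'] at this
    have htend : Tendsto e.symm (𝓝[≠] (e z)) (𝓝[≠] z) := by
      rw [tendsto_nhdsWithin_iff]
      refine ⟨?_, ?_⟩
      · have := (e.continuousAt_symm (e.map_source hz)).tendsto
        rw [e.left_inv hz] at this
        exact this.mono_left nhdsWithin_le_nhds
      · have h1 : ∀ᶠ w in 𝓝[≠] (e z), w ∈ e.target :=
          nhdsWithin_le_nhds (e.open_target.mem_nhds (e.map_source hz))
        filter_upwards [h1, self_mem_nhdsWithin] with w hw hne h
        apply hne
        have h' : e.symm w = z := h
        rw [mem_singleton_iff, ← h', e.right_inv hw]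
    refine Complex.analyticAt_of_differentiable_on_punctured_nhds_of_continuousAt ?_
      (e.continuousAt_symm (e.map_source hz))
    have h1 : ∀ᶠ w in 𝓝[≠] (e z), w ∈ e.target :=
      nhdsWithin_le_nhds (e.open_target.mem_nhds (e.map_source hz))
    filter_upwards [h1, htend.eventually hpun] with w hw hd
    refine (e.hasDerivAt_symm hw hd ?_).differentiableAt
    exact (he.differentiableAt (e.open_source.mem_nhds (e.map_target hw))).hasDerivAt
  intro w hw
  have := key (e.symm w) (e.map_target hw)
  rw [e.right_inv hw] at this
  exact this.differentiableAt.differentiableWithinAt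

variable [IsManifold 𝓘(ℂ) ω X] [IsManifold 𝓘(ℂ) ω Y]

theorem holomorphicAt_chartAt {x y : X} (hy : y ∈ (chartAt ℂ x).source) :
    HolomorphicAt (chartAt ℂ x) y := by
  have : IsManifold 𝓘(ℂ) 1 X := IsManifold.of_le (n := ω) le_top
  filter_upwards [(chartAt ℂ x).open_source.mem_nhds hy] with z hz
  exact mdifferentiableAt_atlas (chart_mem_atlas ℂ x) hz

theorem holomorphicAt_chartAt_symm {x : X} {z : ℂ} (hz : z ∈ (chartAt ℂ x).target) :
    HolomorphicAt (chartAt ℂ x).symm z := by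
  have : IsManifold 𝓘(ℂ) 1 X := IsManifold.of_le (n := ω) le_top
  filter_upwards [(chartAt ℂ x).open_target.mem_nhds hz] with z hz
  exact mdifferentiableAt_atlas_symm (chart_mem_atlas ℂ x) hz

omit [IsManifold 𝓘(ℂ) ω X] [IsManifold 𝓘(ℂ) ω Y] in
theorem holomorphicAt_iff_analyticAt {f : ℂ → ℂ} {z : ℂ} :
    HolomorphicAt f z ↔ AnalyticAt ℂ f z := by
  simp [HolomorphicAt, Complex.analyticAt_iff_eventually_differentiableAt,
    mdifferentiableAt_iff_differentiableAt]

/-- The expression of a holomorphic map in charts is analytic. -/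
theorem HolomorphicAt.analyticAt_chart {f : X → Y} {x : X} (hf : HolomorphicAt f x) :
    AnalyticAt ℂ (chartAt ℂ (f x) ∘ f ∘ (chartAt ℂ x).symm) (chartAt ℂ x x) := by
  have hx : (chartAt ℂ x).symm (chartAt ℂ x x) = x :=
    (chartAt ℂ x).left_inv (mem_chart_source ℂ x)
  rw [← holomorphicAt_iff_analyticAt]
  refine HolomorphicAt.comp (f := f ∘ (chartAt ℂ x).symm) ?_ (HolomorphicAt.comp ?_ ?_)
  · simp only [Function.comp_apply, hx]
    exact holomorphicAt_chartAt (mem_chart_source ℂ (f x))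
  · rwa [hx]
  · exact holomorphicAt_chartAt_symm (mem_chart_target ℂ x)

/-- The local inverses of a holomorphic local homeomorphism are holomorphic. -/
theorem OpenPartialHomeomorph.holomorphicAt_symm (e : OpenPartialHomeomorph X Y)
    (he : ∀ x ∈ e.source, HolomorphicAt e x) {y : Y} (hy : y ∈ e.target) :
    HolomorphicAt e.symm y := by
  set x := e.symm y with hx
  have hxs : x ∈ e.source := e.map_target hy
  set c := chartAt ℂ x
  set d := chartAt ℂ y
  let G : OpenPartialHomeomorph ℂ ℂ := (c.symm.trans e).trans d
  have hG : DifferentiableOn ℂ G G.source := by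
    intro z hz
    simp only [G, OpenPartialHomeomorph.trans_source, mem_inter_iff, mem_preimage,
      OpenPartialHomeomorph.symm_source, OpenPartialHomeomorph.coe_trans,
      Function.comp_apply] at hz
    have : HolomorphicAt (d ∘ e ∘ c.symm) z :=
      HolomorphicAt.comp (f := e ∘ c.symm) (holomorphicAt_chartAt hz.2)
        ((he _ hz.1.2).comp (holomorphicAt_chartAt_symm hz.1.1))
    exact (holomorphicAt_iff_analyticAt.1 this).differentiableAt.differentiableWithinAt
  have hG' := G.holomorphicAt_symm_of_complex hG
  have hdy : d y ∈ G.target := by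
    have : G (c x) = d y := by
      simp [G, c, hx, e.right_inv hy]
    rw [← this]
    refine G.map_source ?_
    simp [G, c, hx, e.right_inv hy, d, e.map_target hy]
  have h1 : HolomorphicAt (c.symm ∘ G.symm ∘ d) y := by
    have h2 : HolomorphicAt G.symm (d y) :=
      holomorphicAt_iff_analyticAt.2 (hG'.analyticAt (G.open_target.mem_nhds hdy))
    refine HolomorphicAt.comp (f := G.symm ∘ d) (holomorphicAt_chartAt_symm ?_)
      (h2.comp (holomorphicAt_chartAt (mem_chart_source ℂ y)))
    have := G.map_target hdy
    simp only [G, OpenPartialHomeomorph.trans_source, mem_inter_iff] at this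
    exact this.1.1
  refine h1.congr ?_
  have hc : ∀ᶠ w in 𝓝 y, e.symm w ∈ c.source :=
    (e.continuousAt_symm hy).eventually (c.open_source.mem_nhds (mem_chart_source ℂ x))
  filter_upwards [hc, d.open_source.mem_nhds (mem_chart_source ℂ y)] with w h3 h4
  simp [G, d.left_inv h4, c.left_inv h3]

variable [IsManifold 𝓘(ℂ) ω Z]

theorem IsLocalHomeomorph.holomorphicAt_localInverseAt {r : X → Y} (hr : IsLocalHomeomorph r)
    (hol : Holomorphic r) (x : X) {y : Y} (hy : y ∈ (hr.localInverseAt x).source) :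
    HolomorphicAt (hr.localInverseAt x) y := by
  have := OpenPartialHomeomorph.holomorphicAt_symm (hr.localInverseAt x).symm
    (fun z _ => by rw [hr.localInverseAt_symm]; exact hol.holomorphicAt z) (y := y) (by simpa)
  simpa using this

omit [IsManifold 𝓘(ℂ) ω Z] in
/-- A map out of `Y` is holomorphic if its pull-back along a local biholomorphism is. -/
theorem Holomorphic.of_comp_right {r : X → Y} (hr : IsLocalHomeomorph r) (hol : Holomorphic r)
    (hs : Function.Surjective r) {F : Y → Z} (hF : Holomorphic (F ∘ r)) : Holomorphic F := by
  refine holomorphic_of_forall fun y => ?_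
  obtain ⟨x, rfl⟩ := hs y
  have h1 := hr.holomorphicAt_localInverseAt hol x (hr.apply_self_mem_localInverseAt_source)
  refine ((hF.holomorphicAt _).comp h1).congr ?_
  filter_upwards [(hr.localInverseAt x).open_source.mem_nhds
    (hr.apply_self_mem_localInverseAt_source)] with w hw
  simp [hr.apply_localInverseAt_of_mem hw]

omit [IsManifold 𝓘(ℂ) ω Z] in
/-- A continuous lift of a holomorphic map along a local biholomorphism is holomorphic. -/
theorem Holomorphic.of_comp_left {r : X → Y} (hr : IsLocalHomeomorph r) (hol : Holomorphic r)
    {F : Z → X} (hc : Continuous F) (hF : Holomorphic (r ∘ F)) : Holomorphic F := by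
  refine holomorphic_of_forall fun z => ?_
  have h1 := hr.holomorphicAt_localInverseAt hol (F z) (hr.apply_self_mem_localInverseAt_source)
  refine (HolomorphicAt.comp (f := r ∘ F) h1 (hF.holomorphicAt _)).congr ?_
  filter_upwards [hc.continuousAt.eventually ((hr.localInverseAt (F z)).open_target.mem_nhds
    (hr.self_mem_localInverseAt_target))] with w hw
  have := (hr.localInverseAt (F z)).right_inv hw
  rwa [hr.localInverseAt_symm] at this

omit [IsManifold 𝓘(ℂ) ω Z] in
/-- Two maps that are holomorphic near `x` either agree near `x`, or differ on a punctured
neighbourhood of `x`. -/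
theorem HolomorphicAt.eventually_eq_or_eventually_ne {f g : X → Y} {x : X}
    (hf : HolomorphicAt f x) (hg : HolomorphicAt g x) (h : f x = g x) :
    f =ᶠ[𝓝 x] g ∨ ∀ᶠ w in 𝓝[≠] x, f w ≠ g w := by
  have hf' := hf.analyticAt_chart
  have hg' := hg.analyticAt_chart
  rw [← h] at hg'
  set c := chartAt ℂ x
  set d := chartAt ℂ (f x)
  have hcs : c.source ∈ 𝓝 x := c.open_source.mem_nhds (mem_chart_source ℂ x)
  have hcc : ContinuousAt c x := c.continuousAt (mem_chart_source ℂ x)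
  rcases hf'.eventually_eq_or_eventually_ne hg' with h1 | h1
  · left
    have h2 := hcc.eventually h1
    have h3 := hf.continuousAt.eventually (d.open_source.mem_nhds (mem_chart_source ℂ _))
    have h4 := hg.continuousAt.eventually
      (d.open_source.mem_nhds (by rw [← h]; exact mem_chart_source ℂ _))
    filter_upwards [h2, h3, h4, hcs] with w h2 h3 h4 h5
    simp only [Function.comp_apply, c.left_inv h5] at h2
    exact d.injOn h3 h4 h2
  · right
    have ht : Tendsto c (𝓝[≠] x) (𝓝[≠] (c x)) := by
      refine tendsto_nhdsWithin_iff.2 ⟨hcc.tendsto.mono_left nhdsWithin_le_nhds, ?_⟩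
      filter_upwards [nhdsWithin_le_nhds hcs, self_mem_nhdsWithin] with w hw hne he
      exact hne (c.injOn hw (mem_chart_source ℂ x) he)
    filter_upwards [ht.eventually h1, nhdsWithin_le_nhds hcs] with w h2 h3 h4
    apply h2
    simp [c.left_inv h3, h4]

end LocalTheory

/-- `f` is injective in a neighbourhood of `x`. -/
def LocallyInjectiveAt {X Y : Type*} [TopologicalSpace X] (f : X → Y) (x : X) : Prop :=
  ∃ V ∈ 𝓝 x, InjOn f V

theorem LocallyInjectiveAt.comp {X Y Z : Type*} [TopologicalSpace X] [TopologicalSpace Y]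
    {g : Y → Z} {f : X → Y} {x : X} (hg : LocallyInjectiveAt g (f x))
    (hf : LocallyInjectiveAt f x) (hc : ContinuousAt f x) : LocallyInjectiveAt (g ∘ f) x := by
  obtain ⟨V, hV, hgV⟩ := hg
  obtain ⟨W, hW, hfW⟩ := hf
  refine ⟨W ∩ f ⁻¹' V, inter_mem hW (hc hV), fun a ha b hb h => hfW ha.1 hb.1 (hgV ha.2 hb.2 h)⟩

theorem IsLocalHomeomorph.locallyInjectiveAt {X Y : Type*} [TopologicalSpace X]
    [TopologicalSpace Y] {f : X → Y} (hf : IsLocalHomeomorph f) (x : X) :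
    LocallyInjectiveAt f x := by
  obtain ⟨V, hV, hx, hi⟩ := hf.isLocallyInjective x
  exact ⟨V, hV.mem_nhds hx, hi⟩

/-! ### Identity theorem, open mapping and surjectivity on Riemann surfaces -/

section Surfaces

variable {X Y Z T : Type*} [TopologicalSpace X] [ChartedSpace ℂ X] [RiemannSurface X]
  [TopologicalSpace Y] [ChartedSpace ℂ Y] [RiemannSurface Y]
  [TopologicalSpace Z] [ChartedSpace ℂ Z] [RiemannSurface Z]
  [TopologicalSpace T] [ChartedSpace ℂ T] [RiemannSurface T]

omit [RiemannSurface X] in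
theorem nhdsNE_neBot_of_chartedSpace_complex (x : X) : (𝓝[≠] x).NeBot := by
  have h := (chartAt ℂ x).symm.map_nhds_eq (mem_chart_target ℂ x)
  rw [(chartAt ℂ x).left_inv (mem_chart_source ℂ x)] at h
  rw [← mem_closure_iff_nhdsWithin_neBot, mem_closure_iff_nhds]
  intro t ht
  rw [← h, mem_map] at ht
  have h2 := (mem_closure_iff_nhds.1 (mem_closure_iff_nhdsWithin_neBot.2
    (inferInstance : (𝓝[≠] (chartAt ℂ x x)).NeBot))) _
    (inter_mem ht ((chartAt ℂ x).open_target.mem_nhds (mem_chart_target ℂ x)))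
  obtain ⟨w, ⟨hw1, hw2⟩, hw3⟩ := h2
  refine ⟨_, hw1, fun h' => hw3 ?_⟩
  have h'' : (chartAt ℂ x).symm w = x := h'
  rw [mem_singleton_iff, ← (chartAt ℂ x).right_inv hw2, h'']

/-- The identity theorem for holomorphic maps between Riemann surfaces. -/
theorem Holomorphic.eq_of_eventuallyEq {f g : X → Y} (hf : Holomorphic f) (hg : Holomorphic g)
    {x : X} (h : f =ᶠ[𝓝 x] g) : f = g := by
  let S : Set X := {z | f =ᶠ[𝓝 z] g}
  have hclosed : IsClosed S := by
    refine isClosed_of_closure_subset fun z hz => ?_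
    have hfg : f z = g z := by
      have : S ⊆ {z | f z = g z} := fun w hw => Eventually.self_of_nhds (p := fun z => f z = g z) hw
      exact closure_minimal this (isClosed_eq hf.continuous hg.continuous) hz
    by_contra hzS
    have hne := ((hf.holomorphicAt z).eventually_eq_or_eventually_ne
      (hg.holomorphicAt z) hfg).resolve_left hzS
    rw [eventually_nhdsWithin_iff] at hne
    obtain ⟨w, hw, hwS⟩ := mem_closure_iff_nhds.1 hz _ hne
    by_cases hwz : w = z
    · exact hzS (hwz ▸ hwS)
    · exact hw hwz (Eventually.self_of_nhds (p := fun z => f z = g z) hwS)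
  have huniv : S = univ := IsClopen.eq_univ ⟨hclosed, isOpen_setOfPred_eventually_nhds⟩ ⟨x, h⟩
  funext z
  have : z ∈ S := huniv ▸ mem_univ z
  exact Eventually.self_of_nhds (p := fun z => f z = g z) this

omit [RiemannSurface X] [RiemannSurface Y] in
theorem holomorphic_const (y : Y) : Holomorphic (fun _ : X => y) := mdifferentiable_const

theorem RiemannSurface.nontrivial (X : Type*) [TopologicalSpace X] [ChartedSpace ℂ X]
    [RiemannSurface X] : Nontrivial X := by
  obtain ⟨x⟩ := (inferInstance : Nonempty X)
  have := nhdsNE_neBot_of_chartedSpace_complex x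
  obtain ⟨y, hy⟩ := (eventually_mem_nhdsWithin (a := x) (s := {x}ᶜ)).exists
  exact ⟨y, x, hy⟩

/-- A holomorphic map is either constant or has isolated fibres. -/
theorem Holomorphic.eventually_ne {f : X → Y} (hf : Holomorphic f) (hs : ¬ ∃ y, ∀ x, f x = y)
    (x : X) : ∀ᶠ w in 𝓝[≠] x, f w ≠ f x := by
  refine ((hf.holomorphicAt x).eventually_eq_or_eventually_ne
    ((holomorphic_const (f x)).holomorphicAt x) rfl).resolve_left fun h => hs ⟨f x, fun z => ?_⟩
  exact congrFun (hf.eq_of_eventuallyEq (holomorphic_const (f x)) h) z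

/-- The open mapping theorem. -/
theorem Holomorphic.nhds_le_map {f : X → Y} (hf : Holomorphic f) (hs : ¬ ∃ y, ∀ x, f x = y)
    (x : X) : 𝓝 (f x) ≤ map f (𝓝 x) := by
  set c := chartAt ℂ x
  set d := chartAt ℂ (f x)
  have hcx : c.symm (c x) = x := c.left_inv (mem_chart_source ℂ x)
  have ha := (hf.holomorphicAt x).analyticAt_chart
  have hds : d.source ∈ 𝓝 (f x) := d.open_source.mem_nhds (mem_chart_source ℂ _)
  rcases ha.eventually_constant_or_nhds_le_map_nhds with h | h
  · exfalso
    have := nhdsNE_neBot_of_chartedSpace_complex x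
    have hcs : ∀ᶠ w in 𝓝 x, w ∈ c.source := c.open_source.mem_nhds (mem_chart_source ℂ x)
    have h1 := (c.continuousAt (mem_chart_source ℂ x)).eventually h
    obtain ⟨w, h2, h3, h4, h5⟩ := ((hf.eventually_ne hs x).and (nhdsWithin_le_nhds (h1.and
      (hcs.and
        (hf.continuous.continuousAt.eventually hds))))).exists
    apply h2
    simp only [Function.comp_apply, c, (chartAt ℂ x).left_inv h4, hcx] at h3
    exact d.injOn h5 (mem_chart_source ℂ _) h3
  · have hmap : map (chartAt ℂ (f x) ∘ f ∘ (chartAt ℂ x).symm) (𝓝 (c x))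
        = map d (map f (𝓝 x)) := by
      rw [← map_map, ← map_map, c.symm.map_nhds_eq (mem_chart_target ℂ x), hcx]
    rw [hmap] at h
    simp only [Function.comp_apply, d] at h
    rw [(chartAt ℂ x).left_inv (mem_chart_source ℂ x),
      ← (chartAt ℂ (f x)).map_nhds_eq (mem_chart_source ℂ (f x))] at h
    intro s hs'
    have h1 : d '' (s ∩ d.source) ∈ map d (map f (𝓝 x)) := by
      refine image_mem_map ?_
      exact inter_mem hs' (hf.continuous.continuousAt hds)
    have h2 := h h1
    rw [mem_map] at h2
    filter_upwards [h2, hds] with w hw hw'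
    obtain ⟨v, hv, hvw⟩ := hw
    rw [← d.injOn hv.2 hw' hvw]
    exact hv.1

/-- A non-constant holomorphic map is locally injective somewhere. -/
theorem Holomorphic.exists_locallyInjectiveAt {f : X → Y} (hf : Holomorphic f)
    (hs : ¬ ∃ y, ∀ x, f x = y) : ∃ x, LocallyInjectiveAt f x := by
  obtain ⟨x⟩ := (inferInstance : Nonempty X)
  set c := chartAt ℂ x
  set d := chartAt ℂ (f x)
  have hcx : c.symm (c x) = x := c.left_inv (mem_chart_source ℂ x)
  have ha := (hf.holomorphicAt x).analyticAt_chart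
  change AnalyticAt ℂ (d ∘ f ∘ c.symm) (c x) at ha
  have hpun : ∀ᶠ w in 𝓝[≠] (c x), deriv (d ∘ f ∘ c.symm) w ≠ 0 := by
    refine ha.deriv.eventually_eq_zero_or_eventually_ne_zero.resolve_left fun h0 => ?_
    obtain ⟨r, hr, hball⟩ := Metric.eventually_nhds_iff_ball.1
      (h0.and ha.eventually_analyticAt)
    have hconst : ∀ w ∈ Metric.ball (c x) r, (d ∘ f ∘ c.symm) w = (d ∘ f ∘ c.symm) (c x) := by
      intro w hw
      refine (Metric.isOpen_ball.is_const_of_deriv_eq_zero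
        (convex_ball (c x) r).isPreconnected ?_ ?_ hw (Metric.mem_ball_self hr))
      · exact fun w hw => (hball w hw).2.differentiableAt.differentiableWithinAt
      · exact fun w hw => (hball w hw).1
    have h1 : ∀ᶠ w in 𝓝 x, c w ∈ Metric.ball (c x) r :=
      (c.continuousAt (mem_chart_source ℂ x)).eventually (Metric.ball_mem_nhds _ hr)
    have := nhdsNE_neBot_of_chartedSpace_complex x
    have hcs : ∀ᶠ w in 𝓝 x, w ∈ c.source := c.open_source.mem_nhds (mem_chart_source ℂ x)
    obtain ⟨w, h2, h3, h4, h5⟩ := ((hf.eventually_ne hs x).and (nhdsWithin_le_nhds (h1.and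
      (hcs.and
        (hf.continuous.continuousAt.eventually
          (d.open_source.mem_nhds (mem_chart_source ℂ _))))))).exists
    apply h2
    have h6 := hconst _ h3
    simp only [Function.comp_apply, c.left_inv h4, hcx] at h6
    exact d.injOn h5 (mem_chart_source ℂ _) h6
  have hev : ∀ᶠ w in 𝓝 (c x), w ∈ c.target := c.open_target.mem_nhds (mem_chart_target ℂ x)
  obtain ⟨w, h1, h2, h3⟩ := (hpun.and (nhdsWithin_le_nhds
    (ha.eventually_analyticAt.and hev))).exists
  refine ⟨c.symm w, ?_⟩
  have hstrict := h2.hasStrictDerivAt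
  have hF := hstrict.hasStrictFDerivAt_equiv h1
  let e := hF.toOpenPartialHomeomorph (d ∘ f ∘ c.symm)
  have hwe : w ∈ e.source := hF.mem_toOpenPartialHomeomorph_source
  refine ⟨c.source ∩ c ⁻¹' e.source, ?_, ?_⟩
  · refine (c.isOpen_inter_preimage e.open_source).mem_nhds ⟨c.map_target h3, ?_⟩
    simpa [c.right_inv h3] using hwe
  · intro a ha b hb hab
    refine c.injOn ha.1 hb.1 (e.injOn ha.2 hb.2 ?_)
    change (d ∘ f ∘ c.symm) (c a) = (d ∘ f ∘ c.symm) (c b)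
    simp [c.left_inv ha.1, c.left_inv hb.1, hab]

/-- The image is open, so closedness suffices. Near a limit point v of the image, take a disc-like
neighbourhood whose frontier avoids the fibre of `τ` through v. A small connected set over `τ v` can
be moved by a deck transformation so that its image meets the neighbourhood; it cannot cross the
frontier, so it stays inside and must hit v. Without the Galois hypothesis this fails, as for the
inclusion of an open subset. -/
theorem Holomorphic.surjective_of_comp {τ : Y → T} {f : X → Y} (hf : Holomorphic f)
    (hτ : Holomorphic τ) (hg : IsGaloisCovering (τ ∘ f)) : Function.Surjective f := by
  have hT := RiemannSurface.nontrivial T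
  have hPc : ¬ ∃ t, ∀ x, (τ ∘ f) x = t := by
    rintro ⟨t, ht⟩
    obtain ⟨t', ht'⟩ := exists_ne t
    obtain ⟨x, hx⟩ := hg.surjective t'
    exact ht' (hx ▸ ht x)
  have hfc : ¬ ∃ y, ∀ x, f x = y := fun ⟨y, hy⟩ => hPc ⟨τ y, fun x => congrArg τ (hy x)⟩
  have hτc : ¬ ∃ t, ∀ y, τ y = t := fun ⟨t, ht⟩ => hPc ⟨t, fun x => ht (f x)⟩
  have hopen : IsOpen (range f) := by
    rw [isOpen_iff_mem_nhds]
    rintro _ ⟨x, rfl⟩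
    exact hf.nhds_le_map hfc x (range_mem_map)
  have : LocallyCompactSpace Y := ChartedSpace.locallyCompactSpace ℂ Y
  have : LocallyConnectedSpace X := ChartedSpace.locallyConnectedSpace ℂ X
  have hclosed : IsClosed (range f) := by
    refine isClosed_of_closure_subset fun v hv => ?_
    have hiso := eventually_nhdsWithin_iff.1 (hτ.eventually_ne hτc v)
    obtain ⟨K, hK, hKs, hKc⟩ := local_compact_nhds hiso
    have hV : interior K ∈ 𝓝 v := interior_mem_nhds.2 hK
    have hfrK : frontier (interior K) ⊆ K :=
      frontier_subset_closure.trans (closure_minimal interior_subset hKc.isClosed)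
    have hfrc : IsCompact (frontier (interior K)) := hKc.of_isClosed_subset isClosed_frontier hfrK
    have hDo : IsOpen (τ '' frontier (interior K))ᶜ :=
      (hfrc.image hτ.continuous).isClosed.isOpen_compl
    have hvD : τ v ∈ (τ '' frontier (interior K))ᶜ := by
      rintro ⟨w, hw, hwv⟩
      refine hKs (hfrK hw) ?_ hwv
      rintro rfl
      rw [isOpen_interior.frontier_eq] at hw
      exact hw.2 (mem_of_mem_nhds hV)
    obtain ⟨z, hz⟩ := hg.surjective (τ v)
    have hpre : (τ ∘ f) ⁻¹' (τ '' frontier (interior K))ᶜ ∈ 𝓝 z :=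
      (hDo.preimage hg.holomorphic.continuous).mem_nhds (by
        rw [mem_preimage, hz]; exact hvD)
    obtain ⟨B, ⟨hBo, hzB, hBc⟩, hBs⟩ :=
      (LocallyConnectedSpace.open_connected_basis z).mem_iff.1 hpre
    have hPB : (τ ∘ f) '' B ∈ 𝓝 (τ v) := by
      rw [← hz]
      exact hg.holomorphic.nhds_le_map hPc z (image_mem_map (hBo.mem_nhds hzB))
    -- `f z2` is a point of the image close to `v`, and `z3` lies in `B` over the same point of `T`;
    -- the deck transformation `a` with `a z3 = z2` carries `B` to where its image meets `interior
    -- K`.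
    obtain ⟨_, ⟨hw1, ⟨z3, hz3B, hz3⟩⟩, ⟨z2, rfl⟩⟩ := mem_closure_iff_nhds.1 hv _
      (inter_mem hV (hτ.continuous.continuousAt hPB))
    obtain ⟨a, ha, haz⟩ := hg.transitive z3 z2 hz3
    have hconn : IsPreconnected ((fun x => f (a x)) '' B) :=
      hBc.isPreconnected.image _ (hf.continuous.comp a.continuous).continuousOn
    have hsub : (fun x => f (a x)) '' B ⊆ interior K := by
      refine hconn.subset_left_of_subset_union isOpen_interior
        (isClosed_closure (s := interior K)).isOpen_compl
        (disjoint_compl_right.mono_left subset_closure) ?_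
        ⟨f z2, ⟨z3, hz3B, congrArg f haz⟩, hw1⟩
      rintro _ ⟨y, hyB, rfl⟩
      by_contra hnot
      simp only [mem_union, mem_compl_iff, not_or, not_not] at hnot
      refine hBs hyB ⟨f (a y), ?_, ha.2 y⟩
      rw [isOpen_interior.frontier_eq]
      exact ⟨hnot.2, hnot.1⟩
    have hmem : f (a z) ∈ interior K := hsub ⟨z, hzB, rfl⟩
    refine ⟨a z, ?_⟩
    by_contra hne
    exact hKs (interior_subset hmem) hne ((ha.2 z).trans hz)
  exact range_eq_univ.1 (IsClopen.eq_univ ⟨hclosed, hopen⟩ (range_nonempty f))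

end Surfaces

/-! ### Galois coverings that are local homeomorphisms -/

section Coverings

variable {X Y : Type*} [TopologicalSpace X] [ChartedSpace ℂ X]
  [TopologicalSpace Y] [ChartedSpace ℂ Y]

omit [ChartedSpace ℂ Y] in
/-- Deck transformations of a locally injective map are determined by one value. -/
theorem eq_of_mem_deckGroup [RiemannSurface X] {p : X → Y} (hp : IsLocalHomeomorph p)
    {g h : X ≃ₜ X} (hg : g ∈ deckGroup p) (hh : h ∈ deckGroup p) {x : X} (hx : g x = h x) :
    g = h := by
  apply Homeomorph.ext
  intro y
  refine congrFun ((T2Space.isSeparatedMap p).eq_of_comp_eq hp.isLocallyInjective g.continuous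
    h.continuous ?_ x hx) y
  funext z
  exact (hg.2 z).trans (hh.2 z).symm

/-- The deck group acts properly discontinuously: if a translate of a set on which `p` is injective
meets that set, the deck transformation has a fixed point and is trivial. -/
theorem IsGaloisCovering.isCoveringMap_of_isLocalHomeomorph [RiemannSurface X] {p : X → Y}
    (hg : IsGaloisCovering p) (hp : IsLocalHomeomorph p) : IsCoveringMap p := by
  let act : MulAction (deckGroup p) X :=
    { smul := fun g x => (g : X ≃ₜ X) x
      one_smul := fun _ => rfl
      mul_smul := fun _ _ _ => rfl }
  refine IsQuotientCoveringMap.isCoveringMap (f := p) (G := deckGroup p) ?_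
  refine (isQuotientCoveringMap_iff ..).2 ⟨?_, ⟨fun g => (g : X ≃ₜ X).continuous⟩, ?_, ?_⟩
  · exact hp.isOpenMap.isQuotientMap hp.continuous hg.surjective
  · intro x y
    constructor
    · intro h
      obtain ⟨g, hg1, hg2⟩ := hg.transitive y x h.symm
      exact ⟨⟨g, hg1⟩, hg2⟩
    · rintro ⟨g, rfl⟩
      exact g.2.2 y
  · intro x
    obtain ⟨V, hV, hi⟩ := hp.locallyInjectiveAt x
    refine ⟨V, hV, ?_⟩
    rintro g ⟨_, ⟨v, hv, rfl⟩, hgv⟩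
    have h1 : (g : X ≃ₜ X) v = v := hi hgv hv (g.2.2 v)
    exact Subtype.ext (eq_of_mem_deckGroup hp g.2 (one_mem _) h1)

end Coverings

/-! ### Orbit spaces and their complex structure -/

section OrbitSpace

variable {X : Type u} [TopologicalSpace X]

/-- The orbit relation of a group of self-homeomorphisms. -/
def orbitSetoid (N : Subgroup (X ≃ₜ X)) : Setoid X where
  r x y := ∃ n ∈ N, n x = y
  iseqv :=
    { refl := fun _ => ⟨1, one_mem _, rfl⟩
      symm := by
        rintro x _ ⟨n, hn, rfl⟩
        exact ⟨n⁻¹, inv_mem hn, n.symm_apply_apply x⟩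
      trans := by
        rintro x _ _ ⟨n, hn, rfl⟩ ⟨m, hm, rfl⟩
        exact ⟨m * n, mul_mem hm hn, rfl⟩ }

/-- The quotient of `X` by a group of self-homeomorphisms. -/
def OrbitSpace (N : Subgroup (X ≃ₜ X)) : Type u := Quotient (orbitSetoid N)

instance (N : Subgroup (X ≃ₜ X)) : TopologicalSpace (OrbitSpace N) :=
  inferInstanceAs (TopologicalSpace (Quotient (orbitSetoid N)))

/-- The projection to the orbit space. -/
def OrbitSpace.mk (N : Subgroup (X ≃ₜ X)) (x : X) : OrbitSpace N := Quotient.mk (orbitSetoid N) x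

variable {N : Subgroup (X ≃ₜ X)}

theorem OrbitSpace.mk_eq_iff {x y : X} :
    OrbitSpace.mk N x = OrbitSpace.mk N y ↔ ∃ n ∈ N, n x = y :=
  Quotient.eq (r := orbitSetoid N)

theorem OrbitSpace.mk_surjective : Function.Surjective (OrbitSpace.mk N) := Quotient.mk_surjective

theorem OrbitSpace.isQuotientMap_mk : IsQuotientMap (OrbitSpace.mk N) := isQuotientMap_quotient_mk'

theorem OrbitSpace.continuous_mk : Continuous (OrbitSpace.mk N) := isQuotientMap_mk.continuous

theorem OrbitSpace.isOpenMap_mk : IsOpenMap (OrbitSpace.mk N) := by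
  intro V hV
  rw [← isQuotientMap_mk.isOpen_preimage]
  have : OrbitSpace.mk N ⁻¹' (OrbitSpace.mk N '' V) = ⋃ n ∈ N, n ⁻¹' V := by
    ext x
    simp only [mem_preimage, mem_image, mem_iUnion]
    constructor
    · rintro ⟨y, hy, hyx⟩
      obtain ⟨n, hn, rfl⟩ := mk_eq_iff.1 hyx.symm
      exact ⟨n, hn, hy⟩
    · rintro ⟨n, hn, hx⟩
      exact ⟨n x, hx, (mk_eq_iff.2 ⟨n, hn, rfl⟩).symm⟩
  rw [this]
  exact isOpen_biUnion fun n _ => hV.preimage n.continuous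

theorem OrbitSpace.isLocalHomeomorph_mk (h : ∀ x, LocallyInjectiveAt (OrbitSpace.mk N) x) :
    IsLocalHomeomorph (OrbitSpace.mk N) := by
  rw [isLocalHomeomorph_iff_isOpenEmbedding_restrict]
  intro x
  obtain ⟨V, hV, hi⟩ := h x
  refine ⟨interior V, interior_mem_nhds.2 hV, ?_⟩
  refine IsOpenEmbedding.of_continuous_injective_isOpenMap
    (continuous_mk.comp continuous_subtype_val) ?_
    (isOpenMap_mk.comp isOpen_interior.isOpenMap_subtype_val)
  intro a b hab
  exact Subtype.ext (hi (interior_subset a.2) (interior_subset b.2) hab)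

variable [ChartedSpace ℂ X]

/-- The complex structure on an orbit space for which the projection is a local biholomorphism. -/
@[reducible]
noncomputable def OrbitSpace.chartedSpace (h : IsLocalHomeomorph (OrbitSpace.mk N)) :
    ChartedSpace ℂ (OrbitSpace N) := h.chartedSpace mk_surjective

omit [ChartedSpace ℂ X] in
/-- Local inverses of the projection differ by elements of the group. -/
theorem OrbitSpace.localInverse_comp_mk (h : IsLocalHomeomorph (OrbitSpace.mk N)) {x g : X}
    (hx : OrbitSpace.mk N x ∈ (h.localInverseAt g).source) :
    ∃ n ∈ N, (h.localInverseAt g) ∘ OrbitSpace.mk N =ᶠ[𝓝 x] n := by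
  set l := h.localInverseAt g with hl
  have hr : OrbitSpace.mk N (l (OrbitSpace.mk N x)) = OrbitSpace.mk N x :=
    h.apply_localInverseAt_of_mem hx
  obtain ⟨n, hn, hnx⟩ := OrbitSpace.mk_eq_iff.1 hr.symm
  refine ⟨n, hn, ?_⟩
  have h1 : ∀ᶠ w in 𝓝 x, n w ∈ l.target :=
    n.continuous.continuousAt.eventually (l.open_target.mem_nhds (by
      rw [hnx]; exact l.map_source hx))
  filter_upwards [h1] with w hw
  have h2 : OrbitSpace.mk N w = OrbitSpace.mk N (n w) := OrbitSpace.mk_eq_iff.2 ⟨n, hn, rfl⟩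
  have h3 := l.right_inv hw
  rw [hl, h.localInverseAt_symm, ← hl] at h3
  rw [Function.comp_apply, h2, h3]

variable [RiemannSurface X]

/-- Two local sections of the projection differ by an element of `N`, so the transition maps are
elements of `N` read in charts of `X`. -/
theorem OrbitSpace.isManifold (h : IsLocalHomeomorph (OrbitSpace.mk N)) (hN : N ≤ holoAut X) :
    letI := OrbitSpace.chartedSpace h
    IsManifold 𝓘(ℂ) ω (OrbitSpace N) := by
  let _ := OrbitSpace.chartedSpace h
  refine isManifold_of_contDiffOn _ _ _ ?_
  rintro _ _ ⟨a, rfl⟩ ⟨b, rfl⟩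
  simp only [modelWithCornersSelf_coe, Function.id_comp, modelWithCornersSelf_coe_symm,
    Function.comp_id, preimage_id, range_id, inter_univ]
  -- The charts are built from chosen preimages; only their existence matters.
  generalize (mk_surjective (N := N)).hasRightInverse.choose a = ga
  generalize (mk_surjective (N := N)).hasRightInverse.choose b = gb
  set la := h.localInverseAt ga with hla
  set lb := h.localInverseAt gb with hlb
  set ca := chartAt ℂ ga
  set cb := chartAt ℂ gb
  refine DifferentiableOn.contDiffOn ?_ (OpenPartialHomeomorph.open_source _)
  intro z hz
  refine DifferentiableAt.differentiableWithinAt ?_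
  simp only [OpenPartialHomeomorph.trans_source, OpenPartialHomeomorph.trans_symm_eq_symm_trans_symm,
    OpenPartialHomeomorph.symm_source, mem_inter_iff, mem_preimage,
    OpenPartialHomeomorph.coe_trans, Function.comp_apply] at hz
  obtain ⟨⟨hz1, hz2⟩, hz3, hz4⟩ := hz
  rw [hla, h.localInverseAt_symm] at hz3 hz4
  obtain ⟨n, hn, hnl⟩ := localInverse_comp_mk h hz3
  have hn2 : lb (mk N (ca.symm z)) = n (ca.symm z) := hnl.self_of_nhds
  rw [hn2] at hz4
  have h1 : HolomorphicAt (cb ∘ n ∘ ca.symm) z := by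
    refine HolomorphicAt.comp (f := n ∘ ca.symm) (holomorphicAt_chartAt hz4)
      (HolomorphicAt.comp ((hN hn).1.holomorphicAt _) (holomorphicAt_chartAt_symm hz1))
  refine (holomorphicAt_iff_analyticAt.1 (h1.congr ?_)).differentiableAt
  have h2 := (ca.continuousAt_symm hz1).eventually hnl
  filter_upwards [h2] with w hw
  simp only [Function.comp_apply] at hw
  simp only [Function.comp_apply, OpenPartialHomeomorph.trans_symm_eq_symm_trans_symm,
    OpenPartialHomeomorph.coe_trans]
  rw [hla, h.localInverseAt_symm, hw]

theorem OrbitSpace.riemannSurface (h : IsLocalHomeomorph (OrbitSpace.mk N)) (hN : N ≤ holoAut X)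
    (hT : T2Space (OrbitSpace N)) :
    letI := OrbitSpace.chartedSpace h
    RiemannSurface (OrbitSpace N) := by
  let _ := OrbitSpace.chartedSpace h
  have h1 := OrbitSpace.isManifold h hN
  have h2 : ConnectedSpace (OrbitSpace N) := mk_surjective.connectedSpace continuous_mk
  exact { toT2Space := hT, toConnectedSpace := h2, toIsManifold := h1 }

theorem OrbitSpace.holomorphic_mk (h : IsLocalHomeomorph (OrbitSpace.mk N))
    (hN : N ≤ holoAut X) :
    letI := OrbitSpace.chartedSpace h
    Holomorphic (OrbitSpace.mk N) := by
  let _ := OrbitSpace.chartedSpace h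
  have h1 := OrbitSpace.isManifold h hN
  refine holomorphic_of_forall fun x => ?_
  set z := OrbitSpace.mk N x with hz
  set g := (mk_surjective (N := N)).hasRightInverse.choose z with hg
  have hgz : mk N g = z := (mk_surjective (N := N)).hasRightInverse.choose_spec z
  set l := h.localInverseAt g with hl
  have hchart : chartAt ℂ z = l.trans (chartAt ℂ g) := rfl
  have hzl : mk N x ∈ l.source := by
    rw [← hz, ← hgz]; exact h.apply_self_mem_localInverseAt_source
  obtain ⟨n, hn, hnl⟩ := localInverse_comp_mk h hzl
  have hzl2 : z ∈ (chartAt ℂ z).source := mem_chart_source ℂ z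
  have hnx : l z = n x := hnl.self_of_nhds
  have hlg : l z ∈ (chartAt ℂ g).source := by
    rw [hchart] at hzl2
    exact hzl2.2
  have h2 : HolomorphicAt ((chartAt ℂ z).symm ∘ (chartAt ℂ g) ∘ n) x := by
    refine HolomorphicAt.comp (f := chartAt ℂ g ∘ n) (holomorphicAt_chartAt_symm ?_)
      (HolomorphicAt.comp (holomorphicAt_chartAt (by rw [← hnx]; exact hlg))
        ((hN hn).1.holomorphicAt x))
    rw [Function.comp_apply, ← hnx]
    exact (chartAt ℂ z).map_source hzl2
  refine h2.congr ?_
  have h3 := continuous_mk.continuousAt.eventually ((chartAt ℂ z).open_source.mem_nhds hzl2)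
  filter_upwards [hnl, h3] with w hw hw2
  simp only [Function.comp_apply] at hw
  rw [Function.comp_apply, Function.comp_apply, ← hw]
  exact (chartAt ℂ z).left_inv hw2

end OrbitSpace

/-! ### Lifting and descending automorphisms -/

section Lifting

variable {V S E X U : Type*} [TopologicalSpace V] [ChartedSpace ℂ V] [RiemannSurface V]
  [TopologicalSpace S] [ChartedSpace ℂ S] [RiemannSurface S]
  [TopologicalSpace E] [ChartedSpace ℂ E] [RiemannSurface E]
  [TopologicalSpace X] [ChartedSpace ℂ X] [RiemannSurface X]
  [TopologicalSpace U] [ChartedSpace ℂ U] [RiemannSurface U]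

omit [RiemannSurface X] in
theorem mem_holoAut_of_inverse {f g : X → X} (hf : Holomorphic f) (hg : Holomorphic g)
    (hfg : f ∘ g = id) (hgf : g ∘ f = id) : ∃ e ∈ holoAut X, ⇑e = f :=
  ⟨{ toFun := f, invFun := g, left_inv := congrFun hgf, right_inv := congrFun hfg,
     continuous_toFun := hf.continuous, continuous_invFun := hg.continuous }, ⟨hf, hg⟩, rfl⟩

omit [RiemannSurface V] in
theorem exists_holomorphic_lift [SimplyConnectedSpace V] {p : E → S} (hp : IsCoveringMap p)
    (hol : Holomorphic p) {f : V → S} (hf : Holomorphic f) {v : V} {e : E} (h : p e = f v) :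
    ∃ F : V → E, Holomorphic F ∧ p ∘ F = f ∧ F v = e := by
  have : LocallyPathConnectedSpace V := ChartedSpace.locallyPathConnectedSpace ℂ V
  obtain ⟨F, ⟨h1, h2⟩, -⟩ := hp.existsUnique_continuousMap_lifts ⟨f, hf.continuous⟩ v e h
  have h3 : p ∘ F = f := h2
  exact ⟨F, Holomorphic.of_comp_left hp.isLocalHomeomorph hol F.continuous (h3 ▸ hf), h3, h1⟩

omit [ChartedSpace ℂ S] [RiemannSurface S] in
theorem eq_of_lifts {p : E → S} (hp : IsLocalHomeomorph p) {f g : V → E} (hf : Holomorphic f)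
    (hg : Holomorphic g) (h : ∀ v, p (f v) = p (g v)) {v : V} (hv : f v = g v) : f = g :=
  (T2Space.isSeparatedMap p).eq_of_comp_eq hp.isLocallyInjective hf.continuous hg.continuous
    (funext h) v hv

/-- Automorphisms lift to simply connected coverings. -/
theorem exists_lift_automorphism [SimplyConnectedSpace V] {p : V → S} (hp : IsCoveringMap p)
    (hol : Holomorphic p) {t : S ≃ₜ S} (ht : t ∈ holoAut S) {v w : V} (h : p w = t (p v)) :
    ∃ Φ ∈ holoAut V, (∀ z, p (Φ z) = t (p z)) ∧ Φ v = w := by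
  obtain ⟨F, hF, hpF, hFv⟩ := exists_holomorphic_lift hp hol (Holomorphic.comp ht.1 hol) h
  obtain ⟨G, hG, hpG, hGw⟩ := exists_holomorphic_lift hp hol
    (Holomorphic.comp ht.2 hol) (v := w) (e := v) (by simp [h])
  have hpF' : ∀ z, p (F z) = t (p z) := congrFun hpF
  have hpG' : ∀ z, p (G z) = t.symm (p z) := congrFun hpG
  have h1 : F ∘ G = id := by
    refine eq_of_lifts hp.isLocalHomeomorph (hF.comp hG) mdifferentiable_id (fun z => ?_) (v := w)
      (by simp [hGw, hFv])
    simp [hpF', hpG']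
  have h2 : G ∘ F = id := by
    refine eq_of_lifts hp.isLocalHomeomorph (hG.comp hF) mdifferentiable_id (fun z => ?_) (v := v)
      (by simp [hGw, hFv])
    simp [hpF', hpG']
  obtain ⟨e, he, hef⟩ := mem_holoAut_of_inverse hF hG h1 h2
  exact ⟨e, he, by rw [hef]; exact hpF', by rw [hef]; exact hFv⟩

/-- An automorphism that is compatible with the fibres of a surjective local biholomorphism
descends. -/
theorem exists_descend_automorphism {r : V → X} (hr : IsLocalHomeomorph r) (hol : Holomorphic r)
    (hs : Function.Surjective r) {Φ : V ≃ₜ V} (hΦ : Φ ∈ holoAut V)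
    (h : ∀ v w, r v = r w ↔ r (Φ v) = r (Φ w)) : ∃ g ∈ holoAut X, ∀ v, g (r v) = r (Φ v) := by
  let F : X → X := fun x => r (Φ (Function.surjInv hs x))
  let G : X → X := fun x => r (Φ.symm (Function.surjInv hs x))
  have hF : ∀ v, F (r v) = r (Φ v) := fun v => (h _ _).1 (Function.surjInv_eq hs (r v))
  have hG : ∀ v, G (r v) = r (Φ.symm v) := fun v => by
    refine (h _ _).2 ?_
    simp only [Homeomorph.apply_symm_apply]
    exact Function.surjInv_eq hs (r v)
  have hFh : Holomorphic F := Holomorphic.of_comp_right hr hol hs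
    ((funext hF : F ∘ r = r ∘ Φ) ▸ hol.comp hΦ.1)
  have hGh : Holomorphic G := Holomorphic.of_comp_right hr hol hs
    ((funext hG : G ∘ r = r ∘ Φ.symm) ▸ hol.comp hΦ.2)
  obtain ⟨e, he, hef⟩ := mem_holoAut_of_inverse hFh hGh
    (by funext x; obtain ⟨v, rfl⟩ := hs x; simp [hF, hG])
    (by funext x; obtain ⟨v, rfl⟩ := hs x; simp [hF, hG])
  exact ⟨e, he, by rw [hef]; exact hF⟩

end Lifting

/-! ### The subgroup generated by commutators and k-th powers -/

section PowCommutator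

variable {G : Type*} [Group G]

theorem powCommutator_le {k : ℕ} {Γ H : Subgroup G} (h1 : ∀ a ∈ Γ, ∀ b ∈ Γ, a * b * a⁻¹ * b⁻¹ ∈ H)
    (h2 : ∀ a ∈ Γ, a ^ k ∈ H) : powCommutator k Γ ≤ H := by
  refine sup_le (Subgroup.commutator_le.2 h1) ((Subgroup.closure_le _).2 ?_)
  rintro _ ⟨a, ha, rfl⟩
  exact h2 a ha

theorem commutatorElement_mem_powCommutator {k : ℕ} {Γ : Subgroup G} {a b : G} (ha : a ∈ Γ)
    (hb : b ∈ Γ) : a * b * a⁻¹ * b⁻¹ ∈ powCommutator k Γ :=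
  Subgroup.mem_sup_left (Subgroup.commutator_mem_commutator ha hb)

theorem conj_mem_powCommutator {k : ℕ} {Γ : Subgroup G} {Φ : G} (hΦ : ∀ γ ∈ Γ, Φ * γ * Φ⁻¹ ∈ Γ)
    {γ : G} (hγ : γ ∈ powCommutator k Γ) : Φ * γ * Φ⁻¹ ∈ powCommutator k Γ := by
  have : powCommutator k Γ ≤ (powCommutator k Γ).comap (MulAut.conj Φ).toMonoidHom := by
    refine powCommutator_le (fun a ha b hb => ?_) (fun a ha => ?_)
    · simp only [Subgroup.mem_comap, map_mul, map_inv]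
      exact commutatorElement_mem_powCommutator (hΦ a ha) (hΦ b hb)
    · rw [Subgroup.mem_comap, map_pow]
      exact Subgroup.mem_sup_right (Subgroup.subset_closure ⟨_, hΦ a ha, rfl⟩)
  exact this hγ

end PowCommutator

/-! ### The homology cover: lifts, commutativity of its deck group, the map to U -/

section HomologyCover

variable {S U X : Type*}
    [TopologicalSpace S] [ChartedSpace ℂ S] [RiemannSurface S]
    [TopologicalSpace U] [ChartedSpace ℂ U] [RiemannSurface U]
    [TopologicalSpace X] [ChartedSpace ℂ X] [RiemannSurface X]
    {k : ℕ} {π : X → S}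

instance : RiemannSurface UpperHalfPlane where

omit [RiemannSurface S] [RiemannSurface X] in
theorem IsHomologyCover.isLocalHomeomorph (hπ : IsHomologyCover k π) : IsLocalHomeomorph π := by
  obtain ⟨u, hu, hp, -⟩ := hπ
  have h := (hp.isCoveringMap.isLocalHomeomorph.isLocalHomeomorphOn (s := univ)).of_comp_right
    (hu.isCoveringMap.isLocalHomeomorph.isLocalHomeomorphOn (s := univ))
  rwa [image_univ, hu.surjective.range_eq, ← isLocalHomeomorph_iff_isLocalHomeomorphOn_univ] at h

omit [RiemannSurface S] in
theorem IsHomologyCover.holomorphic (hπ : IsHomologyCover k π) : Holomorphic π := by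
  obtain ⟨u, hu, hp, -⟩ := hπ
  exact Holomorphic.of_comp_right hu.isCoveringMap.isLocalHomeomorph hu.holomorphic hu.surjective
    hp.holomorphic

/-- Automorphisms of `S` lift to the homology cover, with any prescribed value at a point. -/
theorem IsHomologyCover.exists_lift (hπ : IsHomologyCover k π) {t : S ≃ₜ S} (ht : t ∈ holoAut S)
    {x y : X} (h : π y = t (π x)) :
    ∃ g ∈ holoAut X, (∀ z, π (g z) = t (π z)) ∧ g x = y := by
  obtain ⟨u, hu, hp, hΓ⟩ := hπ
  obtain ⟨v, rfl⟩ := hu.surjective x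
  obtain ⟨w, rfl⟩ := hu.surjective y
  obtain ⟨Φ, hΦ, hpΦ, hv⟩ := exists_lift_automorphism hp.isCoveringMap hp.holomorphic ht h
  have hpΦ' : ∀ z, (π ∘ u) (Φ.symm z) = t.symm ((π ∘ u) z) := by
    intro z
    have := hpΦ (Φ.symm z)
    rw [Homeomorph.apply_symm_apply] at this
    rw [this, Homeomorph.symm_apply_apply]
  have hc : ∀ γ ∈ deckGroup (π ∘ u), Φ * γ * Φ⁻¹ ∈ deckGroup (π ∘ u) := fun γ hγ =>
    ⟨mul_mem (mul_mem hΦ hγ.1) (inv_mem hΦ), fun z => by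
      change (π ∘ u) (Φ (γ (Φ.symm z))) = _
      rw [hpΦ, hγ.2, hpΦ', Homeomorph.apply_symm_apply]⟩
  have hc' : ∀ γ ∈ deckGroup (π ∘ u), Φ⁻¹ * γ * Φ⁻¹⁻¹ ∈ deckGroup (π ∘ u) := fun γ hγ =>
    ⟨mul_mem (mul_mem (inv_mem hΦ) hγ.1) (inv_mem (inv_mem hΦ)), fun z => by
      rw [inv_inv]
      change (π ∘ u) (Φ.symm (γ (Φ z))) = _
      rw [hpΦ', hγ.2, hpΦ, Homeomorph.symm_apply_apply]⟩
  -- The fibres of `u` are the orbits of Γ_k. Since `Φ` and its inverse normalise Γ, they normalise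
  -- Γ_k, so `Φ` permutes these fibres.
  have hfib : ∀ v w, u v = u w ↔ u (Φ v) = u (Φ w) := by
    intro v w
    constructor
    · intro hvw
      obtain ⟨γ, hγ, rfl⟩ := hu.transitive v w hvw
      have h1 : Φ * γ * Φ⁻¹ ∈ deckGroup u := by
        rw [hΓ] at hγ ⊢
        exact conj_mem_powCommutator hc hγ
      have h2 := h1.2 (Φ v)
      change u (Φ (γ (Φ.symm (Φ v)))) = _ at h2
      rw [Homeomorph.symm_apply_apply] at h2
      exact h2.symm
    · intro hvw
      obtain ⟨γ, hγ, hγ2⟩ := hu.transitive _ _ hvw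
      have h1 : Φ⁻¹ * γ * Φ⁻¹⁻¹ ∈ deckGroup u := by
        rw [hΓ] at hγ ⊢
        exact conj_mem_powCommutator hc' hγ
      rw [inv_inv] at h1
      have h2 := h1.2 v
      change u (Φ.symm (γ (Φ v))) = _ at h2
      rw [hγ2, Homeomorph.symm_apply_apply] at h2
      exact h2.symm
  obtain ⟨g, hg, hgu⟩ := exists_descend_automorphism hu.isCoveringMap.isLocalHomeomorph
    hu.holomorphic hu.surjective hΦ hfib
  refine ⟨g, hg, fun z => ?_, by rw [hgu, hv]⟩
  obtain ⟨z, rfl⟩ := hu.surjective z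
  rw [hgu]
  exact hpΦ z

theorem IsHomologyCover.isGaloisCovering (hπ : IsHomologyCover k π) : IsGaloisCovering π where
  holomorphic := hπ.holomorphic
  surjective := by
    obtain ⟨u, hu, hp, -⟩ := hπ
    exact hp.surjective.of_comp
  transitive x y h := by
    obtain ⟨g, hg, h1, h2⟩ := hπ.exists_lift (t := 1) (one_mem _) (x := x) (y := y) h.symm
    exact ⟨g, ⟨hg, h1⟩, h2⟩

omit [RiemannSurface S] in
-- Deck transformations of `π` are induced by elements of Γ, whose commutators lie in Γ_k and so act
-- trivially on X.
theorem IsHomologyCover.deckGroup_commute (hπ : IsHomologyCover k π) {a b : X ≃ₜ X}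
    (ha : a ∈ deckGroup π) (hb : b ∈ deckGroup π) : a * b = b * a := by
  have hloc := hπ.isLocalHomeomorph
  obtain ⟨u, hu, hp, hΓ⟩ := hπ
  have key : ∀ a ∈ deckGroup π, ∃ α ∈ deckGroup (π ∘ u), ∀ v, a (u v) = u (α v) := by
    intro a ha
    obtain ⟨v⟩ := (inferInstance : Nonempty UpperHalfPlane)
    obtain ⟨w, hw⟩ := hu.surjective (a (u v))
    obtain ⟨α, hα, hαv⟩ := hp.transitive v w (by
      rw [Function.comp_apply, Function.comp_apply, hw, ha.2])
    refine ⟨α, hα, fun z => ?_⟩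
    refine congrFun (eq_of_lifts (v := v) hloc (f := a ∘ u) (g := u ∘ α)
      (Holomorphic.comp ha.1.1 hu.holomorphic) (hu.holomorphic.comp hα.1.1) (fun z => ?_) ?_) z
    · exact (ha.2 (u z)).trans (hα.2 z).symm
    · simp [hαv, hw]
  obtain ⟨α, hα, hαu⟩ := key a ha
  obtain ⟨β, hβ, hβu⟩ := key b hb
  apply Homeomorph.ext
  intro x
  obtain ⟨v, rfl⟩ := hu.surjective x
  change a (b (u v)) = b (a (u v))
  rw [hβu, hαu, hαu, hβu]
  have h1 : α * β * α⁻¹ * β⁻¹ ∈ deckGroup u := hΓ ▸ commutatorElement_mem_powCommutator hα hβ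
  have h2 := h1.2 (β (α v))
  rw [← h2]
  have h3 : α * β * α⁻¹ * β⁻¹ * (β * α) = α * β := by group
  exact congrArg u (congrArg (fun f : UpperHalfPlane ≃ₜ UpperHalfPlane => f v) h3.symm)

omit [RiemannSurface S] in
/-- The action of a deck transformation of `π` on an abelian covering `U`. -/
theorem exists_deck_of_lift {V : Type*} [TopologicalSpace V] [ChartedSpace ℂ V] [RiemannSurface V]
    {πU : U → S} (hU : IsUnbranchedGaloisCovering πU) {q : V → U} (hq : Holomorphic q)
    {g : V ≃ₜ V} (hg : g ∈ deckGroup (πU ∘ q)) :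
    ∃ a ∈ deckGroup πU, ∀ v, q (g v) = a (q v) := by
  obtain ⟨v⟩ := (inferInstance : Nonempty V)
  obtain ⟨a, ha, hav⟩ := hU.transitive (q v) (q (g v)) (hg.2 v).symm
  refine ⟨a, ha, fun z => congrFun (eq_of_lifts (v := v) hU.isCoveringMap.isLocalHomeomorph
    (f := q ∘ g) (g := a ∘ q) (hq.comp hg.1.1) (Holomorphic.comp ha.1.1 hq) (fun z => ?_)
    hav.symm) z⟩
  exact (hg.2 z).trans (ha.2 _).symm

/-- Lift the universal covering to `P : ℍ → U`. Each element of Γ acts along `P` as a deck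
transformation of `πU`, and these commute and are killed by k; so `P` is invariant under Γ_k and
factors through X. -/
theorem IsHomologyCover.exists_factor (hπ : IsHomologyCover k π) {πU : U → S}
    (hU : IsUnbranchedGaloisCovering πU)
    (habel : ∀ a ∈ deckGroup πU, ∀ b ∈ deckGroup πU, a * b = b * a)
    (hk : Monoid.exponent (deckGroup πU) ∣ k) : ∃ q : X → U, Holomorphic q ∧ πU ∘ q = π := by
  obtain ⟨u, hu, hp, hΓ⟩ := hπ
  obtain ⟨v⟩ := (inferInstance : Nonempty UpperHalfPlane)
  obtain ⟨e, he⟩ := hU.surjective ((π ∘ u) v)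
  obtain ⟨P, hP, hPp, -⟩ := exists_holomorphic_lift hU.isCoveringMap hU.holomorphic
    hp.holomorphic he
  have key : ∀ γ ∈ deckGroup (π ∘ u), ∃ a ∈ deckGroup πU, ∀ z, P (γ z) = a (P z) := by
    intro γ hγ
    rw [← hPp] at hγ
    exact exists_deck_of_lift hU hP hγ
  have hle : powCommutator k (deckGroup (π ∘ u)) ≤ deckGroup P := by
    refine powCommutator_le (fun a ha b hb => ?_) (fun a ha => ?_)
    · refine ⟨mul_mem (mul_mem (mul_mem ha.1 hb.1) (inv_mem ha.1)) (inv_mem hb.1),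
        fun z => ?_⟩
      obtain ⟨α, hα, hαP⟩ := key a ha
      obtain ⟨β, hβ, hβP⟩ := key b hb
      have h1 : ∀ z, P (a (b z)) = P (b (a z)) := by
        intro z
        rw [hαP, hβP, hβP, hαP]
        exact congrArg (fun f : U ≃ₜ U => f (P z)) (habel α hα β hβ)
      have h2 := h1 (a⁻¹ (b⁻¹ z))
      have h3 : b * a * (a⁻¹ * b⁻¹) = 1 := by group
      change P ((a * b * a⁻¹ * b⁻¹) z) = P z
      exact h2.trans (congrArg (fun f : UpperHalfPlane ≃ₜ UpperHalfPlane => P (f z)) h3)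
    · refine ⟨pow_mem ha.1 k, fun z => ?_⟩
      obtain ⟨α, hα, hαP⟩ := key a ha
      have h1 : ∀ n : ℕ, P ((a ^ n) z) = (α ^ n) (P z) := by
        intro n
        induction n with
        | zero => rfl
        | succ n ih =>
          rw [pow_succ', pow_succ']
          change P (a ((a ^ n) z)) = α ((α ^ n) (P z))
          rw [hαP, ih]
      -- For infinite exponent, `Monoid.exponent` is 0, the divisibility forces `k = 0`, and the
      -- equation is trivial.
      have h2 : α ^ k = 1 := by
        have := Monoid.exponent_dvd_iff_forall_pow_eq_one.1 hk ⟨α, hα⟩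
        exact congrArg Subtype.val this
      rw [h1, h2]
      rfl
  have hfib : ∀ z w, u z = u w → P z = P w := by
    intro z w h
    obtain ⟨γ, hγ, rfl⟩ := hu.transitive z w h
    rw [hΓ] at hγ
    exact ((hle hγ).2 z).symm
  have hq : (fun x => P (Function.surjInv hu.surjective x)) ∘ u = P :=
    funext fun z => hfib _ _ (Function.surjInv_eq hu.surjective (u z))
  refine ⟨fun x => P (Function.surjInv hu.surjective x), ?_, ?_⟩
  · exact Holomorphic.of_comp_right hu.isCoveringMap.isLocalHomeomorph hu.holomorphic
      hu.surjective (by rw [hq]; exact hP)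
  · funext x
    obtain ⟨z, rfl⟩ := hu.surjective x
    have := congrFun hq z
    simp only [Function.comp_apply] at this ⊢
    rw [this]
    exact congrFun hPp z

theorem IsHomologyCover.isUnbranchedGaloisCovering_factor (hπ : IsHomologyCover k π) {πU : U → S}
    (hU : IsUnbranchedGaloisCovering πU) {q : X → U} (hq : Holomorphic q) (h : πU ∘ q = π) :
    IsUnbranchedGaloisCovering q := by
  have hloc : IsLocalHomeomorph q := IsLocalHomeomorph.of_comp (h ▸ hπ.isLocalHomeomorph)
    hU.isCoveringMap.isLocalHomeomorph hq.continuous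
  have hgal : IsGaloisCovering q :=
    { holomorphic := hq
      surjective := Holomorphic.surjective_of_comp hq hU.holomorphic (h ▸ hπ.isGaloisCovering)
      transitive := by
        intro x y hxy
        obtain ⟨g, hg, hgx⟩ := hπ.isGaloisCovering.transitive x y (by
          rw [← h]; exact congrArg πU hxy)
        refine ⟨g, ⟨hg.1, fun z => ?_⟩, hgx⟩
        refine congrFun (eq_of_lifts (v := x) hU.isCoveringMap.isLocalHomeomorph
          (f := q ∘ g) (g := q) (hq.comp hg.1.1) hq (fun z => ?_) ?_) z
        · have := hg.2 z
          rw [← h] at this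
          exact this
        · simp [hgx, hxy] }
  exact { hgal with isCoveringMap := hgal.isCoveringMap_of_isLocalHomeomorph hloc }

end HomologyCover

/-! ### Local injectivity and analytic continuation on fibre products -/

section LocallyInjective

variable {X Y W : Type*} [TopologicalSpace X] [ChartedSpace ℂ X]
  [TopologicalSpace Y] [ChartedSpace ℂ Y] [TopologicalSpace W]

theorem IsGaloisCovering.locallyInjectiveAt_of_eq {p : X → Y} (hp : IsGaloisCovering p) {x y : X}
    (hx : LocallyInjectiveAt p x) (h : p y = p x) : LocallyInjectiveAt p y := by
  obtain ⟨g, hg, rfl⟩ := hp.transitive y x h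
  obtain ⟨V, hV, hi⟩ := hx
  refine ⟨g ⁻¹' V, g.continuous.continuousAt hV, fun a ha b hb hab => g.injective ?_⟩
  exact hi ha hb (by rw [hg.2, hg.2, hab])

omit [ChartedSpace ℂ X] [TopologicalSpace Y] [ChartedSpace ℂ Y] in
theorem LocallyInjectiveAt.eventuallyEq {p : X → Y} {F G : W → X} {w : W}
    (hp : LocallyInjectiveAt p (F w)) (hF : ContinuousAt F w) (hG : ContinuousAt G w)
    (hFG : F w = G w) (h : ∀ v, p (F v) = p (G v)) : F =ᶠ[𝓝 w] G := by
  obtain ⟨V, hV, hi⟩ := hp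
  filter_upwards [hF hV, hG (hFG ▸ hV)] with v h1 h2
  exact hi h1 h2 (h v)

end LocallyInjective

/-- Analytic continuation of the relation `F₁ x = F₂ w` along a path in the fibre product of
`q : X → U` and `f : W → U`. -/
theorem eq_along_path {X U V W : Type*} [TopologicalSpace X] [ChartedSpace ℂ X] [RiemannSurface X]
    [TopologicalSpace U] [ChartedSpace ℂ U] [RiemannSurface U]
    [TopologicalSpace V] [ChartedSpace ℂ V] [RiemannSurface V]
    [TopologicalSpace W] [ChartedSpace ℂ W] [RiemannSurface W]
    {q : X → U} (hq : IsLocalHomeomorph q) (hol : Holomorphic q) {f : W → U} (hf : Holomorphic f)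
    {F₁ : X → V} (hF₁ : Holomorphic F₁) {F₂ : W → V} (hF₂ : Holomorphic F₂)
    {γ : C(unitInterval, W)} {Γ : C(unitInterval, X)} (hΓ : ∀ t, q (Γ t) = f (γ t))
    (h0 : ∀ᶠ p in 𝓝 (γ 0, Γ 0), q p.2 = f p.1 → F₁ p.2 = F₂ p.1) (t : unitInterval) :
    F₁ (Γ t) = F₂ (γ t) := by
  -- `A` collects the parameters at which the relation holds as a germ on the fibre product. As `q`
  -- is a local homeomorphism, the fibre product is locally the graph of `s ∘ f` over W, even where
  -- `f` branches; so the identity theorem on W makes `A` closed.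
  let A : Set unitInterval := {t | ∀ᶠ p in 𝓝 (γ t, Γ t), q p.2 = f p.1 → F₁ p.2 = F₂ p.1}
  have hA : ∀ t ∈ A, F₁ (Γ t) = F₂ (γ t) := fun t ht =>
    Eventually.self_of_nhds (p := fun p : W × X => q p.2 = f p.1 → F₁ p.2 = F₂ p.1) ht (hΓ t)
  have hopen : IsOpen A := (isOpen_setOfPred_eventually_nhds
    (p := fun p : W × X => q p.2 = f p.1 → F₁ p.2 = F₂ p.1)).preimage
      (f := fun t => (γ t, Γ t)) (by fun_prop)
  have hclosed : IsClosed A := by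
    refine isClosed_of_closure_subset fun t ht => ?_
    have hval : F₁ (Γ t) = F₂ (γ t) := by
      refine closure_minimal hA (isClosed_eq ?_ ?_) ht
      · exact hF₁.continuous.comp Γ.continuous
      · exact hF₂.continuous.comp γ.continuous
    set s := hq.localInverseAt (Γ t) with hs
    have hsrc : f (γ t) ∈ s.source := by
      rw [← hΓ]; exact hq.apply_self_mem_localInverseAt_source
    have hst : s (f (γ t)) = Γ t := by rw [← hΓ]; exact hq.localInverseAt_apply_self
    have hsq : ∀ x ∈ s.target, s (q x) = x := by
      intro x hx
      have := s.right_inv hx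
      rwa [hs, hq.localInverseAt_symm, ← hs] at this
    have htgt : s.target ∈ 𝓝 (Γ t) :=
      s.open_target.mem_nhds hq.self_mem_localInverseAt_target
    have hH : HolomorphicAt (F₁ ∘ s ∘ f) (γ t) :=
      HolomorphicAt.comp (f := s ∘ f) (hF₁.holomorphicAt _)
        (HolomorphicAt.comp (hq.holomorphicAt_localInverseAt hol _ hsrc) (hf.holomorphicAt _))
    rcases hH.eventually_eq_or_eventually_ne (hF₂.holomorphicAt _)
      (by simp only [Function.comp_apply, hst, hval]) with h | h
    · have h1 : ∀ᶠ p in 𝓝 (γ t, Γ t), (F₁ ∘ s ∘ f) p.1 = F₂ p.1 :=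
        (continuous_fst.tendsto (γ t, Γ t)).eventually h
      have h2 : ∀ᶠ p : W × X in 𝓝 (γ t, Γ t), p.2 ∈ s.target :=
        continuous_snd.continuousAt.eventually htgt
      filter_upwards [h1, h2] with p h1 h2 h3
      rw [← h1, Function.comp_apply, Function.comp_apply, ← h3, hsq _ h2]
    · rw [eventually_nhdsWithin_iff] at h
      have h1 : ∀ᶠ t' in 𝓝 t, γ t' ∈ ({γ t}ᶜ : Set W) → (F₁ ∘ s ∘ f) (γ t') ≠ F₂ (γ t') :=
        γ.continuous.continuousAt.eventually h
      have h2 : ∀ᶠ t' in 𝓝 t, Γ t' ∈ s.target := Γ.continuous.continuousAt.eventually htgt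
      obtain ⟨t', ⟨h3, h4⟩, h5⟩ := mem_closure_iff_nhds.1 ht _ (h1.and h2)
      have h6 : s (f (γ t')) = Γ t' := by rw [← hΓ]; exact hsq _ h4
      -- The path may stand still at `γ t`; then the lifted path stands still as well, and the germ
      -- at `t'` is the germ at `t`.
      by_cases h7 : γ t' = γ t
      · have h8 : Γ t' = Γ t := by rw [← h6, h7, hst]
        change ∀ᶠ p in 𝓝 (γ t', Γ t'), _ at h5
        rw [h7, h8] at h5
        exact h5
      · exact absurd (by simp only [Function.comp_apply, h6, hA t' h5]) (h3 h7)
  exact hA t (IsClopen.eq_univ ⟨hclosed, hopen⟩ ⟨0, h0⟩ ▸ mem_univ t)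

theorem mem_normalCore_subgroupOf {G : Type*} [Group G] {K H : Subgroup G} {n : H} :
    n ∈ (K.subgroupOf H).normalCore ↔ ∀ g ∈ H, g * n * g⁻¹ ∈ K := by
  constructor
  · intro h g hg
    exact h ⟨g, hg⟩
  · intro h g
    exact h g g.2

/-- The situation of an unbranched Galois covering `q : X → U` over an unbranched covering
`π = πU ∘ q : X → S` to which the deck transformations of `σ : S → T` lift. -/
structure IsLiftingTower {S U T X : Type*}
    [TopologicalSpace S] [ChartedSpace ℂ S] [TopologicalSpace U] [ChartedSpace ℂ U]
    [TopologicalSpace T] [ChartedSpace ℂ T] [TopologicalSpace X] [ChartedSpace ℂ X]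
    (σ : S → T) (πU : U → S) (π : X → S) (q : X → U) : Prop where
  galois_base : IsGaloisCovering σ
  galois_mid : IsUnbranchedGaloisCovering πU
  galois_top : IsUnbranchedGaloisCovering q
  comp_eq : πU ∘ q = π
  galois_comp : IsGaloisCovering π
  isLocalHomeomorph : IsLocalHomeomorph π
  exists_lift : ∀ t ∈ deckGroup σ, ∀ x y, π y = t (π x) →
    ∃ g ∈ holoAut X, (∀ z, π (g z) = t (π z)) ∧ g x = y

/-! ### The quotient by the core and its universal property -/

section Model

set_option linter.unusedSectionVars false

variable {S U T X Z W : Type u}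
    [TopologicalSpace S] [ChartedSpace ℂ S] [RiemannSurface S]
    [TopologicalSpace U] [ChartedSpace ℂ U] [RiemannSurface U]
    [TopologicalSpace T] [ChartedSpace ℂ T] [RiemannSurface T]
    [TopologicalSpace X] [ChartedSpace ℂ X] [RiemannSurface X]
    [TopologicalSpace Z] [ChartedSpace ℂ Z] [RiemannSurface Z]
    [TopologicalSpace W] [ChartedSpace ℂ W] [RiemannSurface W]
    {σ : S → T} {πU : U → S} {π : X → S} {q : X → U}

/-- `r : X → Z` is the quotient by the core of the deck group of `q` in the group of lifts, and
`f : Z → U` is the induced map. -/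
structure IsCoreQuotient (σ : S → T) (π : X → S) (q : X → U) (r : X → Z) (f : Z → U) : Prop where
  holomorphic : Holomorphic r
  isLocalHomeomorph : IsLocalHomeomorph r
  surjective : Function.Surjective r
  holomorphic_map : Holomorphic f
  comp_eq : f ∘ r = q
  -- The core enters only through its orbits (`IsLiftingTower.exists_core_iff`), so the notion
  -- passes to any surface isomorphic to `Z` over `U`.
  eq_iff : ∀ x y, r x = r y ↔ ∀ g ∈ liftGroup π (deckGroup σ), q (g x) = q (g y)

theorem IsLiftingTower.apply_eq (h : IsLiftingTower σ πU π q) (x : X) : πU (q x) = π x :=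
  congrFun h.comp_eq x

theorem base_apply_of_mem_liftGroup {g : X ≃ₜ X}
    (hg : g ∈ liftGroup π (deckGroup σ)) (x : X) : σ (π (g x)) = σ (π x) := by
  obtain ⟨-, t, ht, hgt⟩ := hg
  rw [hgt, ht.2]

theorem IsLiftingTower.exists_mem_liftGroup (h : IsLiftingTower σ πU π q) {x y : X}
    (hxy : σ (π x) = σ (π y)) : ∃ g ∈ liftGroup π (deckGroup σ), g x = y := by
  obtain ⟨t, ht, htx⟩ := h.galois_base.transitive _ _ hxy
  obtain ⟨g, hg, h1, h2⟩ := h.exists_lift t ht x y htx.symm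
  exact ⟨g, ⟨hg, t, ht, h1⟩, h2⟩

theorem IsLiftingTower.deckGroup_le (h : IsLiftingTower σ πU π q) :
    deckGroup q ≤ deckGroup π := fun g hg =>
  ⟨hg.1, fun x => by rw [← h.apply_eq, hg.2, h.apply_eq]⟩

theorem deckGroup_le_liftGroup (σ : S → T) (π : X → S) :
    deckGroup π ≤ liftGroup π (deckGroup σ) := fun _ hg => ⟨hg.1, 1, one_mem _, hg.2⟩

theorem mem_coreInLift_iff {n : liftGroup π (deckGroup σ)} :
    n ∈ coreInLift π (deckGroup σ) q ↔
      ∀ g ∈ liftGroup π (deckGroup σ), ∀ x, q (g ((n : X ≃ₜ X) x)) = q (g x) := by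
  rw [mem_normalCore_subgroupOf]
  constructor
  · intro hn g hg x
    have := (hn g hg).2 (g x)
    change q (g ((n : X ≃ₜ X) (g.symm (g x)))) = _ at this
    rwa [Homeomorph.symm_apply_apply] at this
  · intro hn g hg
    refine ⟨mul_mem (mul_mem hg.1 n.2.1) (inv_mem hg.1), fun x => ?_⟩
    change q (g ((n : X ≃ₜ X) (g.symm x))) = q x
    rw [hn g hg, Homeomorph.apply_symm_apply]

/-- The fibres of the maps `q ∘ g`, with `g` a lift, are the orbits of the core. -/
theorem IsLiftingTower.exists_core_iff (h : IsLiftingTower σ πU π q) {x y : X} :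
    (∃ n ∈ (coreInLift π (deckGroup σ) q).map (liftGroup π (deckGroup σ)).subtype, n x = y) ↔
      ∀ g ∈ liftGroup π (deckGroup σ), q (g x) = q (g y) := by
  constructor
  · rintro ⟨_, ⟨n, hn, rfl⟩, rfl⟩ g hg
    exact (mem_coreInLift_iff.1 hn g hg x).symm
  · intro hxy
    obtain ⟨n, hn, rfl⟩ := h.galois_top.transitive x y (hxy 1 (one_mem _))
    refine ⟨n, ⟨⟨n, deckGroup_le_liftGroup σ π (h.deckGroup_le hn)⟩, ?_, rfl⟩, rfl⟩
    refine mem_coreInLift_iff.2 fun g hg z => ?_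
    refine congrFun (eq_of_lifts (v := x) h.galois_mid.isCoveringMap.isLocalHomeomorph
      (f := q ∘ g ∘ n) (g := q ∘ g) (h.galois_top.holomorphic.comp (Holomorphic.comp hg.1.1 hn.1.1))
      (h.galois_top.holomorphic.comp hg.1.1) (fun z => ?_) (hxy g hg).symm) z
    obtain ⟨-, t, ht, hgt⟩ := hg
    simp only [Function.comp_apply]
    rw [h.apply_eq, h.apply_eq, hgt, hgt, (h.deckGroup_le hn).2]

theorem IsLiftingTower.exists_isCoreQuotient (h : IsLiftingTower σ πU π q) :
    ∃ (Z : Type u) (_ : TopologicalSpace Z) (_ : ChartedSpace ℂ Z) (_ : RiemannSurface Z)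
      (r : X → Z) (f : Z → U), IsCoreQuotient σ π q r f := by
  set N := (coreInLift π (deckGroup σ) q).map (liftGroup π (deckGroup σ)).subtype with hN
  have hmk : ∀ x y, OrbitSpace.mk N x = OrbitSpace.mk N y ↔
      ∀ g ∈ liftGroup π (deckGroup σ), q (g x) = q (g y) := fun x y =>
    OrbitSpace.mk_eq_iff.trans h.exists_core_iff
  have hqmk : ∀ x y, OrbitSpace.mk N x = OrbitSpace.mk N y → q x = q y := fun x y hxy =>
    (hmk x y).1 hxy 1 (one_mem _)
  have hloc : IsLocalHomeomorph (OrbitSpace.mk N) := OrbitSpace.isLocalHomeomorph_mk fun x => by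
    obtain ⟨V, hV, hi⟩ := h.galois_top.isCoveringMap.isLocalHomeomorph.locallyInjectiveAt x
    exact ⟨V, hV, fun a ha b hb hab => hi ha hb (hqmk a b hab)⟩
  have hNh : N ≤ holoAut X := by
    rintro _ ⟨n, -, rfl⟩
    exact n.2.1
  have hT2 : T2Space (OrbitSpace N) := by
    -- The maps `q ∘ g` jointly embed the orbit space continuously and injectively in a product of
    -- copies of the Hausdorff space `U`.
    let F : OrbitSpace N → (liftGroup π (deckGroup σ) → U) :=
      Quotient.lift (fun x g => q ((g : X ≃ₜ X) x)) fun x y hxy => by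
        funext g
        exact h.exists_core_iff.1 hxy g g.2
    have hF : Continuous F := by
      refine continuous_quot_lift _ (continuous_pi fun g => ?_)
      exact h.galois_top.holomorphic.continuous.comp (g : X ≃ₜ X).continuous
    refine T2Space.of_injective_continuous (f := F) ?_ hF
    intro z w hzw
    obtain ⟨x, rfl⟩ := OrbitSpace.mk_surjective z
    obtain ⟨y, rfl⟩ := OrbitSpace.mk_surjective w
    exact (hmk x y).2 fun g hg => congrFun hzw ⟨g, hg⟩
  let _ := OrbitSpace.chartedSpace hloc
  have hRS := OrbitSpace.riemannSurface hloc hNh hT2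
  have hhol := OrbitSpace.holomorphic_mk hloc hNh
  let f : OrbitSpace N → U := Quotient.lift q fun x y hxy =>
    h.exists_core_iff.1 hxy 1 (one_mem _)
  have hf : f ∘ OrbitSpace.mk N = q := rfl
  exact ⟨OrbitSpace N, inferInstance, inferInstance, hRS, OrbitSpace.mk N, f,
    { holomorphic := hhol
      isLocalHomeomorph := hloc
      surjective := OrbitSpace.mk_surjective
      holomorphic_map := Holomorphic.of_comp_right hloc hhol OrbitSpace.mk_surjective
        (by rw [hf]; exact h.galois_top.holomorphic)
      comp_eq := hf
      eq_iff := hmk }⟩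

variable {r : X → Z} {f : Z → U}

theorem IsCoreQuotient.apply_eq (hr : IsCoreQuotient σ π q r f) (x : X) : f (r x) = q x :=
  congrFun hr.comp_eq x

theorem IsCoreQuotient.isLocalHomeomorph_map (hr : IsCoreQuotient σ π q r f)
    (h : IsLiftingTower σ πU π q) : IsLocalHomeomorph f := by
  have h1 := IsLocalHomeomorphOn.of_comp_right (g := f) (f := r) (s := univ)
    (by rw [hr.comp_eq]; exact h.galois_top.isCoveringMap.isLocalHomeomorph.isLocalHomeomorphOn)
    hr.isLocalHomeomorph.isLocalHomeomorphOn
  rwa [image_univ, hr.surjective.range_eq, ← isLocalHomeomorph_iff_isLocalHomeomorphOn_univ] at h1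

/-- Every lift descends to the quotient by the core. -/
theorem IsCoreQuotient.exists_descend (hr : IsCoreQuotient σ π q r f)
    (h : IsLiftingTower σ πU π q) {g : X ≃ₜ X} (hg : g ∈ liftGroup π (deckGroup σ)) :
    ∃ d ∈ deckGroup ((σ ∘ πU) ∘ f), ∀ x, d (r x) = r (g x) := by
  obtain ⟨d, hd, hdr⟩ := exists_descend_automorphism hr.isLocalHomeomorph hr.holomorphic
    hr.surjective hg.1 (fun v w => by
      rw [hr.eq_iff, hr.eq_iff]
      constructor
      · intro H a ha
        exact H (a * g) (mul_mem ha hg)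
      · intro H a ha
        have := H (a * g⁻¹) (mul_mem ha (inv_mem hg))
        change q (a (g.symm (g v))) = q (a (g.symm (g w))) at this
        simpa using this)
  refine ⟨d, ⟨hd, fun z => ?_⟩, hdr⟩
  obtain ⟨x, rfl⟩ := hr.surjective z
  simp only [Function.comp_apply, hdr, hr.apply_eq, h.apply_eq, base_apply_of_mem_liftGroup hg]

theorem IsCoreQuotient.isGaloisCovering (hr : IsCoreQuotient σ π q r f)
    (h : IsLiftingTower σ πU π q) : IsGaloisCovering ((σ ∘ πU) ∘ f) where
  holomorphic := (h.galois_base.holomorphic.comp h.galois_mid.holomorphic).comp hr.holomorphic_map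
  surjective := by
    intro t
    obtain ⟨s, rfl⟩ := h.galois_base.surjective t
    obtain ⟨x, rfl⟩ := h.galois_comp.surjective s
    exact ⟨r x, by simp [hr.apply_eq, h.apply_eq]⟩
  transitive := by
    intro z w hzw
    obtain ⟨x, rfl⟩ := hr.surjective z
    obtain ⟨y, rfl⟩ := hr.surjective w
    simp only [Function.comp_apply, hr.apply_eq, h.apply_eq] at hzw
    obtain ⟨g, hg, rfl⟩ := h.exists_mem_liftGroup hzw
    obtain ⟨d, hd, hdr⟩ := hr.exists_descend h hg
    exact ⟨d, hd, hdr x⟩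

theorem IsLiftingTower.exists_locallyInjectiveAt (h : IsLiftingTower σ πU π q) :
    ∃ s, LocallyInjectiveAt σ s := by
  refine h.galois_base.holomorphic.exists_locallyInjectiveAt ?_
  rintro ⟨t, ht⟩
  have := RiemannSurface.nontrivial T
  obtain ⟨t', ht'⟩ := exists_ne t
  obtain ⟨s, rfl⟩ := h.galois_base.surjective t'
  exact ht' (ht s)

theorem IsLiftingTower.locallyInjectiveAt_comp (h : IsLiftingTower σ πU π q) {v : U} {s : S}
    (hs : LocallyInjectiveAt σ s) (hv : σ (πU v) = σ s) : LocallyInjectiveAt (σ ∘ πU) v :=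
  (h.galois_base.locallyInjectiveAt_of_eq hs hv).comp
    (h.galois_mid.isCoveringMap.isLocalHomeomorph.locallyInjectiveAt v)
    h.galois_mid.isCoveringMap.continuous.continuousAt

/-- The universal property of the quotient by the core. -/
theorem IsCoreQuotient.exists_map (hr : IsCoreQuotient σ π q r f) (h : IsLiftingTower σ πU π q)
    {f' : W → U} (hf' : Holomorphic f') (hW : IsGaloisCovering ((σ ∘ πU) ∘ f')) {w : W} {x : X}
    (hwx : q x = f' w) (hs : LocallyInjectiveAt σ (π x)) :
    ∃ k : W → Z, Holomorphic k ∧ f ∘ k = f' ∧ k w = r x := by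
  have hqloc := h.galois_top.isCoveringMap.isLocalHomeomorph
  have hfloc := hr.isLocalHomeomorph_map h
  have hτ : Holomorphic (σ ∘ πU) := h.galois_base.holomorphic.comp h.galois_mid.holomorphic
  have hsurj := Holomorphic.surjective_of_comp hf' hτ hW
  have : LocallyPathConnectedSpace W := ChartedSpace.locallyPathConnectedSpace ℂ W
  have : PathConnectedSpace W := pathConnectedSpace_iff_connectedSpace.2 inferInstance
  -- Each `q ∘ g`, continued along a path of W and its lift to X, is computed by a function on W
  -- alone, namely `f' ∘ a` with `a` a deck transformation of W → T sending `w` over `q (g x)`.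
  have key : ∀ g ∈ liftGroup π (deckGroup σ), ∃ F : W → U, ∀ (γ : C(unitInterval, W)) (Γ : C(unitInterval, X)),
      γ 0 = w → Γ 0 = x → (∀ t, q (Γ t) = f' (γ t)) → ∀ t, q (g (Γ t)) = F (γ t) := by
    intro g hg
    obtain ⟨w', hw'⟩ := hsurj (q (g x))
    obtain ⟨a, ha, rfl⟩ := hW.transitive w w' (by
      simp only [Function.comp_apply, hw', ← hwx, h.apply_eq, base_apply_of_mem_liftGroup hg])
    refine ⟨f' ∘ a, fun γ Γ hγ0 hΓ0 hΓ t => ?_⟩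
    refine eq_along_path hqloc h.galois_top.holomorphic hf' (F₁ := q ∘ g) (F₂ := f' ∘ a)
      (h.galois_top.holomorphic.comp hg.1.1) (hf'.comp ha.1.1) hΓ ?_ t
    rw [hγ0, hΓ0]
    -- The unramified base point is used here: `q ∘ g` and `f' ∘ a` have equal images in T on the
    -- fibre product, and `σ ∘ πU` is injective near their common value.
    obtain ⟨V, hV, hi⟩ := h.locallyInjectiveAt_comp (v := q (g x)) hs (by
      rw [h.apply_eq, base_apply_of_mem_liftGroup hg])
    have h1 : ∀ᶠ p : W × X in 𝓝 (w, x), q (g p.2) ∈ V :=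
      ((h.galois_top.holomorphic.continuous.comp (g.continuous.comp
        continuous_snd)).continuousAt (x := (w, x))).eventually hV
    have h2 : ∀ᶠ p : W × X in 𝓝 (w, x), f' (a p.1) ∈ V :=
      ((hf'.continuous.comp (a.continuous.comp
        continuous_fst)).continuousAt (x := (w, x))).eventually (by
          simpa [hw'] using hV)
    filter_upwards [h1, h2] with p h1 h2 hp
    refine hi h1 h2 ?_
    have h3 := ha.2 p.1
    simp only [Function.comp_apply] at h3 ⊢
    rw [h3, h.apply_eq, base_apply_of_mem_liftGroup hg, ← hp, h.apply_eq]
  have hlift : ∀ γ : C(unitInterval, W), γ 0 = w →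
      ∃ Γ : C(unitInterval, X), Γ 0 = x ∧ ∀ t, q (Γ t) = f' (γ t) := by
    intro γ hγ
    obtain ⟨Γ, h1, h2⟩ := h.galois_top.isCoveringMap.exists_path_lifts
      ((⟨f', hf'.continuous⟩ : C(W, U)).comp γ) x (by simp [hγ, hwx])
    exact ⟨Γ, h2, congrFun h1⟩
  have hZ : ∀ (γ : C(unitInterval, W)) (Γ : C(unitInterval, Z)) (Γ' : C(unitInterval, X)), γ 0 = w → Γ 0 = r x → Γ' 0 = x →
      (∀ t, q (Γ' t) = f' (γ t)) → f ∘ Γ = (⟨f', hf'.continuous⟩ : C(W, U)).comp γ →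
      Γ 1 = r (Γ' 1) := by
    intro γ Γ Γ' hγ hΓ hΓ' h1 h2
    refine congrFun ((T2Space.isSeparatedMap f).eq_of_comp_eq hfloc.isLocallyInjective
      (g₁ := Γ) (g₂ := r ∘ Γ') Γ.continuous (hr.holomorphic.continuous.comp Γ'.continuous) ?_ 0
      (by simp [hΓ, hΓ'])) 1
    rw [h2]
    funext t
    simp [hr.apply_eq, h1]
  -- Monodromy for the local homeomorphism `f`: paths lift through X, and the end of a lift is
  -- determined by the end of the path because, by `key`, all the `q ∘ g` are.
  obtain ⟨k, ⟨hkw, hk⟩, -⟩ := hfloc.existsUnique_continuousMap_lifts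
    (⟨f', hf'.continuous⟩ : C(W, U)) w (r x) (by simp [hr.apply_eq, hwx]) (by
      intro γ hγ
      obtain ⟨Γ, h1, h2⟩ := hlift γ hγ
      refine ⟨(⟨r, hr.holomorphic.continuous⟩ : C(X, Z)).comp Γ, by simp [h1], ?_⟩
      funext t
      simp [hr.apply_eq, h2]) (by
      intro γ γ' Γ Γ' hγ hγ' hΓ hΓ' h1 h1' h2
      obtain ⟨Δ, hΔ, hΔ2⟩ := hlift γ hγ
      obtain ⟨Δ', hΔ', hΔ2'⟩ := hlift γ' hγ'
      rw [hZ γ Γ Δ hγ hΓ hΔ hΔ2 h1, hZ γ' Γ' Δ' hγ' hΓ' hΔ' hΔ2' h1', hr.eq_iff]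
      intro g hg
      obtain ⟨F, hF⟩ := key g hg
      rw [hF γ Δ hγ hΔ hΔ2, hF γ' Δ' hγ' hΔ' hΔ2', h2])
  have hk' : f ∘ k = f' := hk
  exact ⟨k, Holomorphic.of_comp_left hfloc hr.holomorphic_map k.continuous (by rw [hk']; exact hf'),
    hk', hkw⟩

/-- The universal property gives a map back from W. The round trip on Z covers the identity of U and
fixes a point, so it is the identity; the other one follows since `k` is surjective. -/
theorem IsCoreQuotient.isGaloisClosure (hr : IsCoreQuotient σ π q r f)
    (h : IsLiftingTower σ πU π q) : IsGaloisClosure (σ ∘ πU) f where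
  holomorphic := hr.holomorphic_map
  galois := hr.isGaloisCovering h
  minimal := by
    intro W _ _ _ f' k hf' hW hk hfk
    obtain ⟨s, hs⟩ := h.exists_locallyInjectiveAt
    obtain ⟨x, rfl⟩ := h.galois_comp.surjective s
    obtain ⟨k', hk', hfk', hkx⟩ := hr.exists_map h hf' hW (w := k (r x)) (x := x)
      (by rw [← hr.apply_eq, ← hfk]; rfl) hs
    have h1 : k' ∘ k = id := by
      refine eq_of_lifts (v := r x) (hr.isLocalHomeomorph_map h) (hk'.comp hk) mdifferentiable_id
        (fun z => ?_) hkx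
      rw [← hfk'] at hfk
      exact congrFun hfk z
    refine ⟨k', hk', h1, ?_⟩
    have hs : Function.Surjective k := by
      refine Holomorphic.surjective_of_comp hk hW.holomorphic ?_
      have := hr.isGaloisCovering h
      rwa [← hfk] at this
    funext w
    obtain ⟨z, rfl⟩ := hs w
    exact congrArg k (congrFun h1 z)

/-- Every Galois closure is the quotient by the core. -/
theorem IsLiftingTower.exists_isCoreQuotient_of_isGaloisClosure (h : IsLiftingTower σ πU π q)
    {f : Z → U} (hf : IsGaloisClosure (σ ∘ πU) f) :
    ∃ r : X → Z, IsCoreQuotient σ π q r f := by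
  obtain ⟨Z₀, _, _, _, r, f₀, hr⟩ := h.exists_isCoreQuotient
  obtain ⟨s, hs⟩ := h.exists_locallyInjectiveAt
  obtain ⟨x, rfl⟩ := h.galois_comp.surjective s
  have hτ : Holomorphic (σ ∘ πU) := h.galois_base.holomorphic.comp h.galois_mid.holomorphic
  obtain ⟨z, hz⟩ := Holomorphic.surjective_of_comp hf.holomorphic hτ hf.galois (q x)
  obtain ⟨k, hk, hfk, -⟩ := hr.exists_map h hf.holomorphic hf.galois hz.symm hs
  -- The minimality of the given closure, tested on the model `Z₀`, inverts the comparison map `k`.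
  obtain ⟨k', hk', h1, h2⟩ := hf.minimal Z₀ f₀ k hr.holomorphic_map (hr.isGaloisCovering h) hk hfk
  obtain ⟨e, he, hek⟩ : ∃ e : Z₀ ≃ₜ Z, ⇑e = k' ∧ ⇑e.symm = k :=
    ⟨{ toFun := k', invFun := k, left_inv := congrFun h2, right_inv := congrFun h1,
       continuous_toFun := hk'.continuous, continuous_invFun := hk.continuous }, rfl, rfl⟩
  refine ⟨k' ∘ r,
    { holomorphic := hk'.comp hr.holomorphic
      isLocalHomeomorph := by rw [← he]; exact e.isLocalHomeomorph.comp hr.isLocalHomeomorph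
      surjective := by rw [← he]; exact e.surjective.comp hr.surjective
      holomorphic_map := hf.holomorphic
      comp_eq := by
        rw [← hfk, ← hr.comp_eq]
        funext x
        exact congrArg f₀ (congrFun h2 (r x))
      eq_iff := fun x y => by
        rw [← hr.eq_iff, ← he]
        exact e.injective.eq_iff }⟩

end Model

/-! ### Group theory of split extensions by a cyclic group -/

theorem exists_mulEquiv_zmod {G : Type*} [Group G] {D : Subgroup G} {φ : G}
    (hD : D = Subgroup.zpowers φ) {l : ℕ} (hl : 0 < l) (hord : orderOf φ = l) :
    ∃ ε : D ≃* Multiplicative (ZMod l), (∀ t : D, (t : G) = φ ^ (Multiplicative.toAdd (ε t)).val) ∧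
      ∀ t : D, (t : G) = φ → ε t = Multiplicative.ofAdd 1 := by
  subst hD
  have : NeZero l := ⟨hl.ne'⟩
  have hg : ∀ x : Subgroup.zpowers φ, x ∈ Subgroup.zpowers (⟨φ, Subgroup.mem_zpowers φ⟩ :
      Subgroup.zpowers φ) := by
    rintro ⟨_, n, rfl⟩
    exact ⟨n, rfl⟩
  have hc : Nat.card (Subgroup.zpowers φ) = l := by rw [Nat.card_zpowers, hord]
  set ε := zmodMulEquivOfGenerator hg hc
  refine ⟨ε.symm, fun t => ?_, fun t ht => ?_⟩
  · obtain ⟨z, rfl⟩ := ε.surjective t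
    rw [MulEquiv.symm_apply_apply]
    have h1 := zmodMulEquivOfGenerator_apply_ofAdd_intCast hg hc ((Multiplicative.toAdd z).val : ℤ)
    rw [Int.cast_natCast, ZMod.natCast_zmod_val, ofAdd_toAdd] at h1
    rw [zpow_natCast] at h1
    exact congrArg Subtype.val h1
  · have : t = ⟨φ, Subgroup.mem_zpowers φ⟩ := Subtype.ext ht
    rw [this]
    exact zmodMulEquivOfGenerator_symm_apply_generator hg hc

/-- An extension of a cyclic group that splits is a semidirect product. -/
theorem exists_semidirectProduct_equiv {G D : Type*} [Group G] [Group D] {M N : Subgroup G}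
    [N.Normal] {ρ : G →* D} (hρ : Function.Surjective ρ) (hker : ρ.ker = N) (hNM : N ≤ M) {l : ℕ}
    {j : G →* Multiplicative (ZMod l)} (hj : j.ker = M)
    (hcomm : ∀ a ∈ M, ∀ b ∈ M, a * b = b * a) {s : G} (hs : j s = Multiplicative.ofAdd 1)
    (hsl : s ^ l ∈ N) :
    ∃ (α : Multiplicative (ZMod l) →* MulAut (M ⧸ N.subgroupOf M))
      (e : D ≃* (M ⧸ N.subgroupOf M) ⋊[α] Multiplicative (ZMod l)),
      (∀ Ψ : G, j Ψ = Multiplicative.ofAdd 1 → ∀ m m' : M, (m' : G) = Ψ * m * Ψ⁻¹ →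
        α (Multiplicative.ofAdd 1) (QuotientGroup.mk m) = QuotientGroup.mk m') ∧
      ∀ g, (e (ρ g)).right = j g := by
  have hsl' : ρ s ^ l = 1 := by
    rw [← map_pow]
    exact MonoidHom.mem_ker.1 (hker ▸ hsl)
  -- The splitting: `1` goes to `ρ s`, which is allowed because `ρ s ^ l = 1`.
  obtain ⟨β, hβ⟩ : ∃ β : Multiplicative (ZMod l) →* D, β (Multiplicative.ofAdd 1) = ρ s := by
    let b : ZMod l →+ Additive D := ZMod.lift l
      ⟨zmultiplesHom (Additive D) (Additive.ofMul (ρ s)), by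
        simp [← ofMul_pow, hsl']⟩
    refine ⟨AddMonoidHom.toMultiplicativeLeft b, ?_⟩
    have : b ((1 : ℤ) : ZMod l) = Additive.ofMul (ρ s) := by
      simp only [b, ZMod.lift_coe]
      simp
    rw [Int.cast_one] at this
    exact congrArg Additive.toMul this
  let ι : (M ⧸ N.subgroupOf M) →* D := QuotientGroup.lift (N.subgroupOf M) (ρ.comp M.subtype)
    (fun m hm => by
      have : (m : G) ∈ ρ.ker := hker ▸ Subgroup.mem_subgroupOf.1 hm
      exact this)
  have hι : ∀ m : M, ι (QuotientGroup.mk m) = ρ m := fun m => rfl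
  have hιinj : Function.Injective ι := by
    rw [injective_iff_map_eq_one]
    intro k hk
    obtain ⟨m, rfl⟩ := QuotientGroup.mk_surjective k
    rw [hι] at hk
    rw [QuotientGroup.eq_one_iff, Subgroup.mem_subgroupOf, ← hker]
    exact hk
  have hrange : ι.range = M.map ρ := by
    ext d
    constructor
    · rintro ⟨k, rfl⟩
      obtain ⟨m, rfl⟩ := QuotientGroup.mk_surjective k
      exact ⟨m, m.2, rfl⟩
    · rintro ⟨m, hm, rfl⟩
      exact ⟨QuotientGroup.mk ⟨m, hm⟩, rfl⟩
  have hMn : M.Normal := hj ▸ inferInstance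
  have hrn : ι.range.Normal := hrange ▸ hMn.map ρ hρ
  let E : (M ⧸ N.subgroupOf M) ≃* ι.range := MonoidHom.ofInjective hιinj
  have hE : ∀ k, (E k : D) = ι k := fun k => rfl
  let α : Multiplicative (ZMod l) →* MulAut (M ⧸ N.subgroupOf M) :=
    (MulAut.congr E.symm).toMonoidHom.comp (MulAut.conjNormal.comp β)
  have hα : ∀ z k, ι (α z k) = β z * ι k * (β z)⁻¹ := by
    intro z k
    have h1 : α z k = E.symm (MulAut.conjNormal (β z) (E k)) := rfl
    rw [h1, ← hE, MulEquiv.apply_symm_apply, MulAut.conjNormal_apply, hE]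
  let jD : D →* Multiplicative (ZMod l) := ρ.liftOfSurjective hρ ⟨j, by rw [hker, hj]; exact hNM⟩
  have hjD : ∀ g, jD (ρ g) = j g := fun g =>
    MonoidHom.liftOfRightInverse_comp_apply ρ _ _ ⟨j, by rw [hker, hj]; exact hNM⟩ g
  have hjι : ∀ k, jD (ι k) = 1 := by
    intro k
    obtain ⟨m, rfl⟩ := QuotientGroup.mk_surjective k
    rw [hι, hjD]
    exact MonoidHom.mem_ker.1 (hj ▸ m.2)
  have hjβ : ∀ z, jD (β z) = z := by
    intro z
    have h1 : β z = ρ s ^ (Multiplicative.toAdd z).cast (R := ℤ) := by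
      rw [← hβ, ← map_zpow, ← ofAdd_zsmul]
      simp
    rw [h1, map_zpow, hjD, hs, ← ofAdd_zsmul]
    simp
  let F : (M ⧸ N.subgroupOf M) ⋊[α] Multiplicative (ZMod l) →* D := SemidirectProduct.lift ι β
    (fun z => by
      ext k
      simp only [MonoidHom.comp_apply, MulEquiv.coe_toMonoidHom, MulAut.conj_apply]
      exact hα z k)
  have hF : ∀ x, F x = ι x.left * β x.right := fun x => rfl
  have hjF : ∀ x, jD (F x) = x.right := fun x => by rw [hF, map_mul, hjι, hjβ, one_mul]
  have hFbij : Function.Bijective F := by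
    constructor
    · rw [injective_iff_map_eq_one]
      intro x hx
      have h1 : x.right = 1 := by rw [← hjF, hx, map_one]
      rw [hF, h1, map_one, mul_one] at hx
      exact SemidirectProduct.ext (hιinj (hx.trans (map_one ι).symm)) h1
    · intro d
      obtain ⟨g, hg⟩ := hρ (d * (β (jD d))⁻¹)
      have h1 : g ∈ M := by
        rw [← hj, MonoidHom.mem_ker, ← hjD, hg, map_mul, map_inv, hjβ, mul_inv_cancel]
      refine ⟨⟨QuotientGroup.mk ⟨g, h1⟩, jD d⟩, ?_⟩
      rw [hF, hι]
      simp [hg]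
  refine ⟨α, (MulEquiv.ofBijective F hFbij).symm, ?_, ?_⟩
  · intro Ψ hΨ m m' hm
    apply hιinj
    rw [hα, hβ, hι, hι, hm, ← map_mul, ← map_inv, ← map_mul]
    -- Any other element over the generator differs from `s` by an element of the abelian group `M`,
    -- so it conjugates `M` in the same way.
    have h1 : s⁻¹ * Ψ ∈ M := by
      rw [← hj, MonoidHom.mem_ker, map_mul, map_inv, hs, hΨ, inv_mul_cancel]
    have h2 := hcomm _ h1 m m.2
    congr 1
    calc s * m * s⁻¹ = s * (m * (s⁻¹ * Ψ)) * Ψ⁻¹ := by group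
      _ = Ψ * m * Ψ⁻¹ := by rw [← h2]; group
  · intro g
    rw [← hjF, ← hjD]
    congr 1
    exact (MulEquiv.ofBijective F hFbij).apply_symm_apply (ρ g)

/-! ### The deck group of the closure and the two splittings -/

section DeckGroup

set_option linter.unusedSectionVars false

variable {S U T X Z : Type u}
    [TopologicalSpace S] [ChartedSpace ℂ S] [RiemannSurface S]
    [TopologicalSpace U] [ChartedSpace ℂ U] [RiemannSurface U]
    [TopologicalSpace T] [ChartedSpace ℂ T] [RiemannSurface T]
    [TopologicalSpace X] [ChartedSpace ℂ X] [RiemannSurface X]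
    [TopologicalSpace Z] [ChartedSpace ℂ Z] [RiemannSurface Z]
    {σ : S → T} {πU : U → S} {π : X → S} {q : X → U} {r : X → Z} {f : Z → U}

/-- The group of lifts maps onto the deck group of the quotient by the core, and the kernel is
the core. -/
theorem IsCoreQuotient.exists_deckHom (hr : IsCoreQuotient σ π q r f)
    (h : IsLiftingTower σ πU π q) :
    ∃ ρ : liftGroup π (deckGroup σ) →* deckGroup ((σ ∘ πU) ∘ f), Function.Surjective ρ ∧
      ρ.ker = coreInLift π (deckGroup σ) q ∧
      ∀ g x, (ρ g : Z ≃ₜ Z) (r x) = r ((g : X ≃ₜ X) x) := by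
  choose d hd hdr using fun g : liftGroup π (deckGroup σ) => hr.exists_descend h g.2
  let ρ : liftGroup π (deckGroup σ) →* deckGroup ((σ ∘ πU) ∘ f) := MonoidHom.mk'
    (fun g => ⟨d g, hd g⟩) (fun a b => by
      apply Subtype.ext
      apply Homeomorph.ext
      intro z
      obtain ⟨x, rfl⟩ := hr.surjective z
      change d (a * b) (r x) = d a (d b (r x))
      rw [hdr, hdr, hdr]
      rfl)
  have hρ : ∀ g x, (ρ g : Z ≃ₜ Z) (r x) = r ((g : X ≃ₜ X) x) := hdr
  refine ⟨ρ, ?_, ?_, hρ⟩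
  · rintro ⟨D, hD⟩
    obtain ⟨s, hs⟩ := h.exists_locallyInjectiveAt
    obtain ⟨x, rfl⟩ := h.galois_comp.surjective s
    obtain ⟨y, hy⟩ := hr.surjective (D (r x))
    have hxy : σ (π x) = σ (π y) := by
      have := hD.2 (r x)
      rw [← hy] at this
      simp only [Function.comp_apply, hr.apply_eq, h.apply_eq] at this
      exact this.symm
    obtain ⟨g, hg, hgx⟩ := h.exists_mem_liftGroup hxy
    refine ⟨⟨g, hg⟩, Subtype.ext (Homeomorph.ext fun z => ?_)⟩
    -- One common value suffices because `r x` lies over an unramified point: there Z → T is locally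
    -- injective, so the germs agree, and the identity theorem does the rest.
    have hval : (ρ ⟨g, hg⟩ : Z ≃ₜ Z) (r x) = D (r x) := by rw [hρ, ← hy, ← hgx]
    have hfl := hr.isLocalHomeomorph_map h
    have hloc : LocallyInjectiveAt ((σ ∘ πU) ∘ f) ((ρ ⟨g, hg⟩ : Z ≃ₜ Z) (r x)) := by
      refine (h.locallyInjectiveAt_comp hs ?_).comp (hfl.locallyInjectiveAt _)
        hfl.continuous.continuousAt
      rw [hval, ← hy, hr.apply_eq, h.apply_eq, hxy]
    refine congrFun (Holomorphic.eq_of_eventuallyEq (x := r x) (ρ ⟨g, hg⟩).2.1.1 hD.1.1 ?_) z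
    exact hloc.eventuallyEq (ρ ⟨g, hg⟩ : Z ≃ₜ Z).continuous.continuousAt D.continuous.continuousAt
      hval fun v => ((ρ ⟨g, hg⟩).2.2 v).trans (hD.2 v).symm
  · ext n
    rw [MonoidHom.mem_ker, mem_coreInLift_iff]
    constructor
    · intro hn g hg x
      have h1 := hρ n x
      rw [hn] at h1
      exact ((hr.eq_iff _ _).1 h1 g hg).symm
    · intro hn
      refine Subtype.ext (Homeomorph.ext fun z => ?_)
      obtain ⟨x, rfl⟩ := hr.surjective z
      rw [hρ]
      exact (hr.eq_iff _ _).2 fun g hg => hn g hg x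

theorem coreInLift_le_deckInLift (h : IsLiftingTower σ πU π q) :
    coreInLift π (deckGroup σ) q ≤ deckInLift π (deckGroup σ) := fun n hn =>
  h.deckGroup_le (by simpa using mem_normalCore_subgroupOf.1 hn 1 (one_mem _))

/-- The natural map from the group of lifts to the cyclic deck group of `σ`. -/
theorem IsLiftingTower.exists_liftHom (h : IsLiftingTower σ πU π q) {φ : S ≃ₜ S}
    (hφ : deckGroup σ = Subgroup.zpowers φ) {l : ℕ} (hl : 0 < l) (hord : orderOf φ = l) :
    ∃ j : liftGroup π (deckGroup σ) →* Multiplicative (ZMod l),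
      j.ker = deckInLift π (deckGroup σ) ∧
      (∀ (g : liftGroup π (deckGroup σ)) (x : X),
        π ((g : X ≃ₜ X) x) = (φ ^ (Multiplicative.toAdd (j g)).val) (π x)) ∧
      ∀ g : liftGroup π (deckGroup σ), (∀ x, π ((g : X ≃ₜ X) x) = φ (π x)) →
        j g = Multiplicative.ofAdd 1 := by
  have hsurj := h.galois_comp.surjective
  choose t ht htx using fun g : liftGroup π (deckGroup σ) => g.2.2
  have huniq : ∀ (g : liftGroup π (deckGroup σ)) (t' : S ≃ₜ S),
      (∀ x, π ((g : X ≃ₜ X) x) = t' (π x)) → t g = t' := by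
    intro g t' h'
    apply Homeomorph.ext
    intro s
    obtain ⟨x, rfl⟩ := hsurj s
    rw [← htx, h']
  let τ : liftGroup π (deckGroup σ) →* deckGroup σ := MonoidHom.mk' (fun g => ⟨t g, ht g⟩)
    (fun a b => Subtype.ext (huniq (a * b) (t a * t b) fun x => by
      change π ((a : X ≃ₜ X) ((b : X ≃ₜ X) x)) = t a (t b (π x))
      rw [htx, htx]))
  obtain ⟨ε, hε, hεφ⟩ := exists_mulEquiv_zmod hφ hl hord
  refine ⟨ε.toMonoidHom.comp τ, ?_, ?_, ?_⟩
  · ext g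
    rw [MonoidHom.mem_ker, Subgroup.mem_subgroupOf]
    change ε (τ g) = 1 ↔ _
    rw [EmbeddingLike.map_eq_one_iff]
    constructor
    · intro hg
      refine ⟨g.2.1, fun x => ?_⟩
      have h1 : t g = 1 := congrArg Subtype.val hg
      rw [htx, h1]
      rfl
    · intro hg
      exact Subtype.ext (huniq g 1 hg.2)
  · intro g x
    change _ = (φ ^ (Multiplicative.toAdd (ε (τ g))).val) (π x)
    rw [← hε]
    exact htx g x
  · intro g hg
    exact hεφ (τ g) (huniq g φ hg)

theorem IsLiftingTower.exists_lift_generator (h : IsLiftingTower σ πU π q) {φ : S ≃ₜ S}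
    (hφ : φ ∈ deckGroup σ) {x y : X} (hxy : π y = φ (π x)) :
    ∃ g : liftGroup π (deckGroup σ), (∀ z, π ((g : X ≃ₜ X) z) = φ (π z)) ∧
      (g : X ≃ₜ X) x = y := by
  obtain ⟨g, hg, h1, h2⟩ := h.exists_lift φ hφ x y hxy
  exact ⟨⟨g, hg, φ, hφ, h1⟩, h1, h2⟩

theorem pow_mem_deckInLift {φ : S ≃ₜ S} {l : ℕ} (hord : orderOf φ = l)
    {g : liftGroup π (deckGroup σ)} (hg : ∀ z, π ((g : X ≃ₜ X) z) = φ (π z)) :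
    ((g ^ l : liftGroup π (deckGroup σ)) : X ≃ₜ X) ∈ deckGroup π := by
  refine ⟨(g ^ l).2.1, fun z => ?_⟩
  have h1 : ∀ n : ℕ, π (((g : X ≃ₜ X) ^ n) z) = (φ ^ n) (π z) := by
    intro n
    induction n with
    | zero => rfl
    | succ n ih =>
      rw [pow_succ', pow_succ']
      change π ((g : X ≃ₜ X) (((g : X ≃ₜ X) ^ n) z)) = φ ((φ ^ n) (π z))
      rw [hg, ih]
  rw [Subgroup.coe_pow, h1, ← hord, pow_orderOf_eq_one]
  rfl

/-- If `φ` has a fixed point, the extension splits. -/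
theorem IsLiftingTower.exists_section_of_fixedPoint (h : IsLiftingTower σ πU π q) {φ : S ≃ₜ S}
    (hφ : φ ∈ deckGroup σ) {l : ℕ} (hord : orderOf φ = l) {s : S} (hs : φ s = s) :
    ∃ g : liftGroup π (deckGroup σ), (∀ z, π ((g : X ≃ₜ X) z) = φ (π z)) ∧
      g ^ l ∈ coreInLift π (deckGroup σ) q := by
  obtain ⟨x, rfl⟩ := h.galois_comp.surjective s
  obtain ⟨g, hg, hgx⟩ := h.exists_lift_generator hφ (x := x) (y := x) hs.symm
  refine ⟨g, hg, ?_⟩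
  have h1 : ((g ^ l : liftGroup π (deckGroup σ)) : X ≃ₜ X) = 1 := by
    refine eq_of_mem_deckGroup (x := x) h.isLocalHomeomorph (pow_mem_deckInLift hord hg)
      (one_mem _) ?_
    have h2 : ∀ n : ℕ, ((g : X ≃ₜ X) ^ n) x = x := by
      intro n
      induction n with
      | zero => rfl
      | succ n ih =>
        rw [pow_succ']
        change (g : X ≃ₜ X) (((g : X ≃ₜ X) ^ n) x) = x
        rw [ih, hgx]
    exact h2 l
  have h2 : g ^ l = 1 := Subtype.ext h1
  rw [h2]
  exact one_mem _

/-- M_k acts on U through the deck group of `πU`, and deck transformations that act trivially on U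
lie in N₁. -/
theorem IsLiftingTower.pow_exponent_mem (h : IsLiftingTower σ πU π q) {m : X ≃ₜ X}
    (hm : m ∈ deckGroup π) : m ^ Monoid.exponent (deckGroup πU) ∈ deckGroup q := by
  have hm' := hm
  rw [← h.comp_eq] at hm'
  obtain ⟨a, ha, hqa⟩ := exists_deck_of_lift h.galois_mid h.galois_top.holomorphic hm'
  refine ⟨pow_mem hm.1 _, fun x => ?_⟩
  have h1 : ∀ n : ℕ, q ((m ^ n) x) = (a ^ n) (q x) := by
    intro n
    induction n with
    | zero => rfl
    | succ n ih =>
      rw [pow_succ', pow_succ']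
      change q (m ((m ^ n) x)) = a ((a ^ n) (q x))
      rw [hqa, ih]
  have h2 : a ^ Monoid.exponent (deckGroup πU) = 1 :=
    congrArg Subtype.val (Monoid.pow_exponent_eq_one (⟨a, ha⟩ : deckGroup πU))
  rw [h1, h2]
  rfl

/-- M_k is normal in Λ, so every conjugate of the power is again the e-th power of an element of
M_k. -/
theorem IsLiftingTower.pow_exponent_mem_core (h : IsLiftingTower σ πU π q)
    {m : liftGroup π (deckGroup σ)} (hm : (m : X ≃ₜ X) ∈ deckGroup π) :
    m ^ Monoid.exponent (deckGroup πU) ∈ coreInLift π (deckGroup σ) q := by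
  refine mem_normalCore_subgroupOf.2 fun g hg => ?_
  rw [Subgroup.coe_pow, ← conj_pow]
  refine h.pow_exponent_mem ⟨mul_mem (mul_mem hg.1 hm.1) (inv_mem hg.1), fun x => ?_⟩
  obtain ⟨-, t, ht, hgt⟩ := hg
  change π (g ((m : X ≃ₜ X) (g.symm x))) = π x
  rw [hgt, hm.2, ← hgt, Homeomorph.apply_symm_apply]

/-- If `l` is prime to the exponent of the deck group of `U → S`, the extension splits. -/
theorem IsLiftingTower.exists_section_of_coprime (h : IsLiftingTower σ πU π q) {φ : S ≃ₜ S}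
    (hφ : φ ∈ deckGroup σ) {l : ℕ} (hl : 0 < l) (hord : orderOf φ = l)
    (hc : Nat.Coprime l (Monoid.exponent (deckGroup πU)))
    {j : liftGroup π (deckGroup σ) →* Multiplicative (ZMod l)}
    (hj : ∀ g : liftGroup π (deckGroup σ), (∀ x, π ((g : X ≃ₜ X) x) = φ (π x)) →
        j g = Multiplicative.ofAdd 1) :
    ∃ g : liftGroup π (deckGroup σ), j g = Multiplicative.ofAdd 1 ∧
      g ^ l ∈ coreInLift π (deckGroup σ) q := by
  have : NeZero l := ⟨hl.ne'⟩
  set e := Monoid.exponent (deckGroup πU)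
  obtain ⟨x⟩ := (inferInstance : Nonempty X)
  obtain ⟨y, hy⟩ := h.galois_comp.surjective (φ (π x))
  obtain ⟨Ψ, hΨ, -⟩ := h.exists_lift_generator hφ hy
  -- The exponent below is a multiple of `e` congruent to 1 mod `l`: it keeps the image `φ` and
  -- pushes the l-th power into the core. For infinite exponent `e` is 0, and coprimality then means
  -- `l = 1`.
  have h1 : (e : ZMod l) * (e : ZMod l)⁻¹ = 1 := ZMod.coe_mul_inv_eq_one e hc.symm
  refine ⟨Ψ ^ (e * ((e : ZMod l)⁻¹).val), ?_, ?_⟩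
  · rw [map_pow, hj Ψ hΨ, ← ofAdd_nsmul]
    congr 1
    simp [h1]
  · have h2 : (Ψ ^ (e * ((e : ZMod l)⁻¹).val)) ^ l = ((Ψ ^ l) ^ e) ^ ((e : ZMod l)⁻¹).val := by
      simp only [← pow_mul]
      congr 1
      ring
    rw [h2]
    exact pow_mem (h.pow_exponent_mem_core (pow_mem_deckInLift hord hΨ)) _

end DeckGroup

/-! ### The theorem -/

theorem mainTheorem3 {S U T X : Type u}
    [TopologicalSpace S] [ChartedSpace ℂ S] [RiemannSurface S]
    [TopologicalSpace U] [ChartedSpace ℂ U] [RiemannSurface U]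
    [TopologicalSpace T] [ChartedSpace ℂ T] [RiemannSurface T]
    [TopologicalSpace X] [ChartedSpace ℂ X] [RiemannSurface X]
    (hS : IsNonExceptional S)
    -- the unbranched abelian covering of `S`
    (πU : U → S) (hπU : IsUnbranchedGaloisCovering πU)
    (habel : ∀ a ∈ deckGroup πU, ∀ b ∈ deckGroup πU, a * b = b * a)
    -- the (branched) Galois covering `S → T` with deck group `⟨φ⟩` cyclic of order `l`
    (σ : S → T) (hσ : IsGaloisCovering σ)
    (φ : S ≃ₜ S) (hφ : deckGroup σ = Subgroup.zpowers φ)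
    (l : ℕ) (hl : 0 < l) (hord : orderOf φ = l)
    -- `k` is the exponent of the deck group of `πU`, or a multiple of it (`0` stands for `∞`),
    -- and `πk : X → S` is the `k`-homology cover of `S`
    (k : ℕ) (hk : Monoid.exponent (deckGroup πU) ∣ k)
    (πk : X → S) (hπk : IsHomologyCover k πk) :
    -- `U = X / N₁` over `S`, for a subgroup `N₁` of `M_k`
    (∃ q : X → U, IsUnbranchedGaloisCovering q ∧ πU ∘ q = πk) ∧
    -- the Galois closure of `U → T` exists
    (∃ (Z : Type u) (_ : TopologicalSpace Z) (_ : ChartedSpace ℂ Z) (_ : RiemannSurface Z)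
      (f : Z → U), IsGaloisClosure (σ ∘ πU) f) ∧
    -- if `φ` has fixed points or `l` is coprime to the exponent, its deck group is the semidirect product of `K = M_k / N₂` and `ℤ / l`
    ((∃ x : S, φ x = x) ∨ Nat.Coprime l (Monoid.exponent (deckGroup πU)) →
      ∀ q : X → U, Holomorphic q → πU ∘ q = πk →
      ∀ (Z : Type u) [TopologicalSpace Z] [ChartedSpace ℂ Z] [RiemannSurface Z] (f : Z → U),
      IsGaloisClosure (σ ∘ πU) f →
      ∃ (α : Multiplicative (ZMod l) →*
            MulAut (coreQuotient πk (Subgroup.zpowers φ) q))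
        (e : deckGroup ((σ ∘ πU) ∘ f) ≃*
            coreQuotient πk (Subgroup.zpowers φ) q ⋊[α] Multiplicative (ZMod l)),
        -- the generator of `ℤ / l` acts on `K` by conjugation with the lifts of `φ`
        (∀ Ψ : liftGroup πk (Subgroup.zpowers φ),
          (∀ x : X, πk ((Ψ : X ≃ₜ X) x) = φ (πk x)) →
          ∀ m m' : deckInLift πk (Subgroup.zpowers φ),
            (m' : liftGroup πk (Subgroup.zpowers φ)) = Ψ * m * Ψ⁻¹ →
            α (Multiplicative.ofAdd 1) (QuotientGroup.mk m) = QuotientGroup.mk m') ∧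
        -- the projection to `ℤ / l` is the natural map from the deck group to `⟨φ⟩`
        (∀ (g : deckGroup ((σ ∘ πU) ∘ f)) (z : Z),
          πU (f ((g : Z ≃ₜ Z) z)) =
            (φ ^ (Multiplicative.toAdd (e g).right).val) (πU (f z)))) := by
  have tower : ∀ q : X → U, Holomorphic q → πU ∘ q = πk → IsLiftingTower σ πU πk q :=
    fun q hq hqk =>
      { galois_base := hσ
        galois_mid := hπU
        galois_top := hπk.isUnbranchedGaloisCovering_factor hπU hq hqk
        comp_eq := hqk
        galois_comp := hπk.isGaloisCovering
        isLocalHomeomorph := hπk.isLocalHomeomorph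
        exists_lift := fun t ht x y hxy => hπk.exists_lift ht.1 hxy }
  obtain ⟨q₀, hq₀, hq₀k⟩ := hπk.exists_factor hπU habel hk
  refine ⟨⟨q₀, (tower q₀ hq₀ hq₀k).galois_top, hq₀k⟩, ?_, ?_⟩
  · obtain ⟨Z, _, _, _, r, f, hr⟩ := (tower q₀ hq₀ hq₀k).exists_isCoreQuotient
    exact ⟨Z, inferInstance, inferInstance, inferInstance, f,
      hr.isGaloisClosure (tower q₀ hq₀ hq₀k)⟩
  · intro hcase q hq hqk Z _ _ _ f hf
    have h := tower q hq hqk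
    have hφσ : φ ∈ deckGroup σ := hφ ▸ Subgroup.mem_zpowers φ
    rw [← hφ]
    obtain ⟨r, hr⟩ := h.exists_isCoreQuotient_of_isGaloisClosure hf
    obtain ⟨ρ, hρ, hker, hρr⟩ := hr.exists_deckHom h
    obtain ⟨j, hj, hjφ, hj1⟩ := h.exists_liftHom hφ hl hord
    obtain ⟨s, hs, hsl⟩ : ∃ s : liftGroup πk (deckGroup σ), j s = Multiplicative.ofAdd 1 ∧
        s ^ l ∈ coreInLift πk (deckGroup σ) q := by
      rcases hcase with ⟨x, hx⟩ | hc
      · obtain ⟨g, hg, hgl⟩ := h.exists_section_of_fixedPoint hφσ hord hx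
        exact ⟨g, hj1 g hg, hgl⟩
      · exact h.exists_section_of_coprime hφσ hl hord hc hj1
    -- The extension has group Λ, which maps onto the deck group of Z → T with kernel N₂, and onto ℤ
    -- / l with kernel the abelian group M_k.
    obtain ⟨α, e, hα, he⟩ := exists_semidirectProduct_equiv hρ hker (coreInLift_le_deckInLift h)
      hj (fun a ha b hb => Subtype.ext (hπk.deckGroup_commute ha hb)) hs hsl
    refine ⟨α, e, fun Ψ hΨ m m' hm => hα Ψ (hj1 Ψ hΨ) m m' hm, fun g z => ?_⟩
    obtain ⟨g, rfl⟩ := hρ g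
    obtain ⟨x, rfl⟩ := hr.surjective z
    rw [he, hρr, hr.apply_eq, hr.apply_eq, h.apply_eq, h.apply_eq, hjφ]
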